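/- Let $q\in\mathbb{C}$ with $0<|q|<1$, and let $K=\mathbb{C}(\{z\})$ be the field of convergent Laurent series over $\mathbb{C}$ (finitely many negative powers of $z$, convergent on some punctured disc around $0$), with the automorphism $\phi$ given by $\phi(f)(z)=f(qz)$ and the valuation $v$ given by the order at $z=0$. A $q$-difference module over $K$ is a finite dimensional $K$-vector space $M$ with an additive bijection $\Phi:M\to M$ such that $\Phi(fm)=\phi(f)\Phi(m)$ for $f\in K$, $m\in M$. A submodule of it is a $K$-subspace that is stable under $\Phi$ and $\Phi^{-1}$; submodules and quotients by them are again $q$-difference modules. Let $L=\Phi^m+a_{m-1}\Phi^{m-1}+\cdots+a_0$ with $a_i\in K$, $a_0\neq0$, and put $a_m=1$. The Newton polygon of $L$ is the lower boundary of the convex hull of the points $(i,v(a_i))$, $0\le i\le m$, $a_i\ne 0$. A rational number $\lambda$ is called a slope of $L$ if $-\lambda$ is the slope of an edge of this polygon (so $\Phi-cz^t$ with $c\in\mathbb{C}^*$ and $t\in\mathbb{Z}$ has the slope $t$). A $q$-difference module $M$ is pure of slope $\lambda$ if $M\cong K[\Phi,\Phi^{-1}]/K[\Phi,\Phi^{-1}]L$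 for such an $L$ with $\lambda$ as its only slope; that is, there is an $e\in M$ such that $e,\Phi e,\dots,\Phi^{m-1}e$ is a $K$-basis of $M$ and $\Phi^m e+a_{m-1}\Phi^{m-1}e+\cdots+a_0e=0$. (The zero module is not pure.) Theorem. Every $q$-difference module $M$ over $K$ has a unique tower of submodules $0=M_0\subset M_1\subset\cdots\subset M_r=M$ (strict inclusions, $r\ge 0$) such that every quotient $M_i/M_{i-1}$ is pure of some slope $\lambda_i\in\mathbb{Q}$ and $\lambda_1<\cdots<\lambda_r$. That is, such a tower exists, and the number $r$, the submodules $M_i$ and the slopes $\lambda_i$ are uniquely determined by $M$. -/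

import Mathlib

namespace QDiff

open HahnSeries

/-- A formal complex Laurent series (finitely many negative exponents) is convergent if it
converges absolutely at some radius `r > 0`, hence on the punctured disc `0 < |z| ≤ r`. -/
def IsConvergent (f : LaurentSeries ℂ) : Prop :=
  ∃ r : ℝ, 0 < r ∧ Summable fun n : ℤ => ‖f.coeff n‖ * r ^ n

theorem summable_of_le {f : LaurentSeries ℂ} {r s : ℝ} (hs : 0 < s) (hsr : s ≤ r)
    (h : Summable fun n : ℤ => ‖f.coeff n‖ * r ^ n) :
    Summable fun n : ℤ => ‖f.coeff n‖ * s ^ n := by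
  have hr : 0 < r := hs.trans_le hsr
  refine Summable.of_nonneg_of_le (fun n => by positivity) (fun n => ?_)
    (h.mul_left ((s / r) ^ f.order))
  by_cases hn : f.coeff n = 0
  · simp [hn]
  · have h1 : f.order ≤ n := order_le_of_coeff_ne_zero hn
    have h2 : (s / r) ^ n ≤ (s / r) ^ f.order :=
      zpow_le_zpow_right_of_le_one₀ (by positivity) ((div_le_one hr).2 hsr) h1
    have h3 : s ^ n = (s / r) ^ n * r ^ n := by
      rw [div_zpow]; field_simp
    rw [h3]
    calc ‖f.coeff n‖ * ((s / r) ^ n * r ^ n) = (s / r) ^ n * (‖f.coeff n‖ * r ^ n) := by ring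
      _ ≤ _ := mul_le_mul_of_nonneg_right h2 (by positivity)

theorem IsConvergent.common {f g : LaurentSeries ℂ} (hf : IsConvergent f) (hg : IsConvergent g) :
    ∃ r : ℝ, 0 < r ∧ (Summable fun n : ℤ => ‖f.coeff n‖ * r ^ n) ∧
      Summable fun n : ℤ => ‖g.coeff n‖ * r ^ n := by
  obtain ⟨r, hr, hf⟩ := hf
  obtain ⟨s, hs, hg⟩ := hg
  exact ⟨min r s, lt_min hr hs, summable_of_le (lt_min hr hs) (min_le_left _ _) hf,
    summable_of_le (lt_min hr hs) (min_le_right _ _) hg⟩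

theorem IsConvergent.add {f g : LaurentSeries ℂ} (hf : IsConvergent f) (hg : IsConvergent g) :
    IsConvergent (f + g) := by
  obtain ⟨r, hr, hf, hg⟩ := hf.common hg
  refine ⟨r, hr, Summable.of_nonneg_of_le (fun n => by positivity) (fun n => ?_) (hf.add hg)⟩
  rw [coeff_add, ← add_mul]
  exact mul_le_mul_of_nonneg_right (norm_add_le _ _) (by positivity)

theorem IsConvergent.neg {f : LaurentSeries ℂ} (hf : IsConvergent f) : IsConvergent (-f) := by
  obtain ⟨r, hr, hf⟩ := hf
  exact ⟨r, hr, by simpa using hf⟩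

theorem isConvergent_single (k : ℤ) (c : ℂ) : IsConvergent (single k c) := by
  refine ⟨1, one_pos, summable_of_ne_finset_zero (s := {k}) fun n hn => ?_⟩
  rw [coeff_single_of_ne (by simpa using hn)]
  simp

theorem IsConvergent.mul {f g : LaurentSeries ℂ} (hf : IsConvergent f) (hg : IsConvergent g) :
    IsConvergent (f * g) := by
  obtain ⟨r, hr, hf, hg⟩ := hf.common hg
  have hfg := hf.mul_of_nonneg hg (fun n => by positivity) (fun n => by positivity)
  refine ⟨r, hr, summable_of_sum_le (c := ∑' x : ℤ × ℤ, (‖f.coeff x.1‖ * r ^ x.1) *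
    (‖g.coeff x.2‖ * r ^ x.2)) (fun n => by positivity) fun u => ?_⟩
  calc ∑ n ∈ u, ‖(f * g).coeff n‖ * r ^ n
      ≤ ∑ n ∈ u, ∑ x ∈ Finset.antidiagonal f.isPWO_support g.isPWO_support n,
          (‖f.coeff x.1‖ * r ^ x.1) * (‖g.coeff x.2‖ * r ^ x.2) := by
        refine Finset.sum_le_sum fun n _ => ?_
        rw [coeff_mul]
        refine (mul_le_mul_of_nonneg_right (norm_sum_le _ _) (by positivity)).trans ?_
        rw [Finset.sum_mul]
        refine Finset.sum_le_sum fun x hx => ?_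
        have hx' : x.1 + x.2 = n := (Finset.mem_antidiagonal.1 hx).2.2
        rw [← hx', zpow_add₀ hr.ne', norm_mul]
        exact le_of_eq (by ring)
    _ = ∑ x ∈ u.biUnion fun n => Finset.antidiagonal f.isPWO_support g.isPWO_support n,
          (‖f.coeff x.1‖ * r ^ x.1) * (‖g.coeff x.2‖ * r ^ x.2) := by
        rw [Finset.sum_biUnion]
        intro a _ b _ hab
        refine Finset.disjoint_left.2 fun x hxa hxb => hab ?_
        exact (Finset.mem_antidiagonal.1 hxa).2.2.symm.trans (Finset.mem_antidiagonal.1 hxb).2.2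
    _ ≤ _ := hfg.sum_le_tsum _ fun x _ => by positivity

theorem isConvergent_ofPowerSeries {p : PowerSeries ℂ} {r : ℝ} (hr : 0 < r)
    (h : Summable fun n : ℕ => ‖PowerSeries.coeff n p‖ * r ^ n) :
    IsConvergent (ofPowerSeries ℤ ℂ p) := by
  refine ⟨r, hr, ?_⟩
  have hinj : Function.Injective ((↑) : ℕ → ℤ) := Nat.cast_injective
  refine (hinj.summable_iff fun n hn => ?_).1 ?_
  · rw [ofPowerSeries_apply, embDomain_of_notMem_range (by simpa using hn)]
    simp
  · refine h.congr fun n => ?_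
    simp [ofPowerSeries_apply_coeff]

theorem isConvergent_ofPowerSeries_inv {p : PowerSeries ℂ} {r : ℝ} (hr : 0 < r)
    (hp : PowerSeries.constantCoeff p ≠ 0)
    (h : Summable fun n : ℕ => ‖PowerSeries.coeff n p‖ * r ^ n) :
    IsConvergent (ofPowerSeries ℤ ℂ p⁻¹) := by
  set c : ℝ := ‖PowerSeries.constantCoeff p‖ with hc
  have hc0 : 0 < c := norm_pos_iff.2 hp
  set S : ℝ := ∑' n : ℕ, ‖PowerSeries.coeff n p‖ * r ^ n with hS
  have hS0 : 0 ≤ S := tsum_nonneg fun n => by positivity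
  obtain ⟨e, he0, he1, heS⟩ : ∃ e : ℝ, 0 < e ∧ e ≤ 1 ∧ e * S ≤ c := by
    refine ⟨min 1 (c / (S + 1)), lt_min one_pos (by positivity), min_le_left _ _, ?_⟩
    calc min 1 (c / (S + 1)) * S ≤ c / (S + 1) * S :=
          mul_le_mul_of_nonneg_right (min_le_right _ _) hS0
      _ ≤ c := by
          rw [div_mul_eq_mul_div, div_le_iff₀ (by positivity)]
          nlinarith
  have hs : 0 < e * r := by positivity
  have key : ∀ n : ℕ, ‖PowerSeries.coeff n p⁻¹‖ * (e * r) ^ n ≤ c⁻¹ := by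
    intro n
    induction n using Nat.strong_induction_on with
    | _ n ih =>
      rw [PowerSeries.coeff_inv]
      split_ifs with hn
      · subst hn
        simp [hc]
      · rw [norm_mul, norm_neg, norm_inv, ← hc, mul_assoc]
        refine mul_le_of_le_one_right (by positivity) ?_
        refine (mul_le_mul_of_nonneg_right (norm_sum_le _ _) (by positivity)).trans ?_
        rw [Finset.sum_mul]
        calc _ ≤ ∑ x ∈ Finset.HasAntidiagonal.antidiagonal n,
                  c⁻¹ * (e * (‖PowerSeries.coeff x.1 p‖ * r ^ x.1)) := by
                refine Finset.sum_le_sum fun x hx => ?_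
                have hx' : x.1 + x.2 = n := Finset.HasAntidiagonal.mem_antidiagonal.1 hx
                split_ifs with hlt
                · have h1 : x.1 ≠ 0 := by omega
                  have h2 : e ^ x.1 ≤ e := pow_le_of_le_one he0.le he1 h1
                  have h3 := ih x.2 hlt
                  rw [norm_mul, ← hx', _root_.pow_add, mul_pow e r x.1]
                  calc _ = (‖PowerSeries.coeff x.2 p⁻¹‖ * (e * r) ^ x.2) *
                            (e ^ x.1 * (‖PowerSeries.coeff x.1 p‖ * r ^ x.1)) := by ring
                    _ ≤ _ := by gcongr
                · simp only [norm_zero, zero_mul]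
                  positivity
          _ = c⁻¹ * (e * ∑ k ∈ Finset.range (n + 1), ‖PowerSeries.coeff k p‖ * r ^ k) := by
                rw [← Finset.mul_sum, ← Finset.mul_sum,
                  Finset.Nat.sum_antidiagonal_eq_sum_range_succ_mk]
          _ ≤ c⁻¹ * (e * S) := by
                gcongr
                exact h.sum_le_tsum _ fun k _ => by positivity
          _ ≤ 1 := by
                rw [inv_mul_le_iff₀ hc0]
                simpa using heS
  refine isConvergent_ofPowerSeries (r := e * r / 2) (by positivity) ?_
  refine Summable.of_nonneg_of_le (fun n => by positivity) (fun n => ?_)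
    ((summable_geometric_two).mul_left c⁻¹)
  rw [div_eq_mul_one_div (e * r) 2, mul_pow, ← mul_assoc]
  exact mul_le_mul_of_nonneg_right (key n) (by positivity)

theorem IsConvergent.inv {f : LaurentSeries ℂ} (hf : IsConvergent f) : IsConvergent f⁻¹ := by
  by_cases h0 : f = 0
  · simpa [h0] using hf
  have hp : PowerSeries.constantCoeff f.powerSeriesPart ≠ 0 := by
    rw [← PowerSeries.coeff_zero_eq_constantCoeff_apply, LaurentSeries.powerSeriesPart_coeff]
    simpa using coeff_order_eq_zero.not.2 h0
  obtain ⟨r, hr, hs⟩ := hf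
  have hs' : Summable fun n : ℕ => ‖PowerSeries.coeff n f.powerSeriesPart‖ * r ^ n := by
    have h1 := (hs.comp_injective (i := fun n : ℕ => f.order + (n : ℤ))
      fun a b hab => by simpa using hab).mul_left (r ^ (-f.order))
    refine h1.congr fun n => ?_
    simp only [Function.comp, LaurentSeries.powerSeriesPart_coeff, zpow_add₀ hr.ne', zpow_neg,
      zpow_natCast]
    field_simp
  have hinv : f⁻¹ = single (-f.order) 1 * ofPowerSeries ℤ ℂ f.powerSeriesPart⁻¹ := by
    refine inv_eq_of_mul_eq_one_right ?_
    have h2 := LaurentSeries.single_order_mul_powerSeriesPart f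
    calc f * _ = _ := congrArg (· * _) h2.symm
      _ = 1 := ?_
    rw [mul_mul_mul_comm, single_mul_single, ← map_mul,
      PowerSeries.mul_inv_cancel _ hp]
    simp
  rw [hinv]
  exact (isConvergent_single _ _).mul (isConvergent_ofPowerSeries_inv hr hp hs')

/-- The field `K = ℂ({z})` of convergent Laurent series. -/
def ConvLaurent : Subfield (LaurentSeries ℂ) where
  carrier := {f | IsConvergent f}
  mul_mem' := IsConvergent.mul
  one_mem' := isConvergent_single 0 1
  add_mem' := IsConvergent.add
  zero_mem' := by simpa using isConvergent_single 0 0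
  neg_mem' := IsConvergent.neg
  inv_mem' _ := IsConvergent.inv

/-- `f(z) ↦ f(qz)` on formal Laurent series: the coefficient of `z ^ n` is multiplied
by `q ^ n`. -/
noncomputable def dilate (q : ℂˣ) (f : LaurentSeries ℂ) : LaurentSeries ℂ where
  coeff n := (q : ℂ) ^ n * f.coeff n
  isPWO_support' := f.isPWO_support.mono fun n hn h => hn (by simp [h])

theorem dilate_coeff (q : ℂˣ) (f : LaurentSeries ℂ) (n : ℤ) :
    (dilate q f).coeff n = (q : ℂ) ^ n * f.coeff n := rfl

theorem dilate_support (q : ℂˣ) (f : LaurentSeries ℂ) : (dilate q f).support = f.support := by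
  ext n
  simp [dilate_coeff, zpow_ne_zero]

theorem dilate_mul (q : ℂˣ) (f g : LaurentSeries ℂ) :
    dilate q (f * g) = dilate q f * dilate q g := by
  ext n
  rw [dilate_coeff, coeff_mul, coeff_mul_left' f.isPWO_support (dilate_support q f).subset,
    Finset.mul_sum]
  refine Finset.sum_congr ?_ fun x hx => ?_
  · ext x
    simp [dilate_coeff, zpow_ne_zero]
  · rw [← (Finset.mem_antidiagonal.1 hx).2.2, zpow_add₀ q.ne_zero, dilate_coeff, dilate_coeff]
    ring

theorem dilate_add (q : ℂˣ) (f g : LaurentSeries ℂ) :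
    dilate q (f + g) = dilate q f + dilate q g := by
  ext n
  simp [dilate_coeff, mul_add]

theorem dilate_dilate (p q : ℂˣ) (f : LaurentSeries ℂ) :
    dilate p (dilate q f) = dilate (p * q) f := by
  ext n
  simp [dilate_coeff, mul_zpow, mul_assoc]

theorem dilate_one (f : LaurentSeries ℂ) : dilate 1 f = f := by
  ext n
  simp [dilate_coeff]

theorem IsConvergent.dilate {f : LaurentSeries ℂ} (hf : IsConvergent f) (q : ℂˣ) :
    IsConvergent (dilate q f) := by
  obtain ⟨r, hr, h⟩ := hf
  have hq : 0 < ‖(q : ℂ)‖ := norm_pos_iff.2 q.ne_zero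
  refine ⟨r / ‖(q : ℂ)‖, by positivity, h.congr fun n => ?_⟩
  rw [dilate_coeff, norm_mul, norm_zpow, div_zpow]
  field_simp

/-- The automorphism `φ` of `K` with `φ(f)(z) = f(qz)`. -/
noncomputable def qShift (q : ℂˣ) : ConvLaurent ≃+* ConvLaurent where
  toFun f := ⟨dilate q f, IsConvergent.dilate f.2 q⟩
  invFun f := ⟨dilate q⁻¹ f, IsConvergent.dilate f.2 q⁻¹⟩
  left_inv f := Subtype.ext (by simp [dilate_dilate, dilate_one])
  right_inv f := Subtype.ext (by simp [dilate_dilate, dilate_one])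
  map_mul' f g := Subtype.ext (dilate_mul q f g)
  map_add' f g := Subtype.ext (dilate_add q f g)

/-- The order at `z = 0` of a convergent Laurent series; it is the valuation `v` on nonzero
elements, and is only ever applied to those. -/
noncomputable def ord (f : ConvLaurent) : ℤ := (f : LaurentSeries ℂ).order

/-- The slopes of the Newton polygon of `L = a₀ + a₁ Φ + ⋯ + a_m Φ ^ m`. The polygon is the lower
boundary of the convex hull of the points `(i, v(a_i))` with `a_i ≠ 0`. An edge of it is carried by
a line through two of these points such that no point lies below the line. The sign is
normalized such that `Φ - c z ^ t` has slope `t`: the line `y = h - lam * x` gives the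
slope `lam`. -/
def newtonSlopes {m : ℕ} (a : Fin (m + 1) → ConvLaurent) : Set ℚ :=
  {lam | ∃ h : ℚ,
    (∃ i j : Fin (m + 1), i ≠ j ∧ a i ≠ 0 ∧ a j ≠ 0 ∧
      (ord (a i) : ℚ) = h - lam * ((i : ℕ) : ℚ) ∧ (ord (a j) : ℚ) = h - lam * ((j : ℕ) : ℚ)) ∧
    ∀ k : Fin (m + 1), a k ≠ 0 → h - lam * ((k : ℕ) : ℚ) ≤ (ord (a k) : ℚ)}

section Modules

variable {q : ℂˣ} {M : Type*} [AddCommGroup M] [Module ConvLaurent M]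

/-- `(M, Φ)` is isomorphic to `K[Φ, Φ⁻¹] / K[Φ, Φ⁻¹] L` for the monic operator
`L = Φ ^ m + a_{m-1} Φ ^ (m-1) + ⋯ + a₀` with `a₀ ≠ 0`: there is a vector `e` (the image of `1`)
such that `e, Φ e, …, Φ ^ (m-1) e` is a basis of `M` over `K`, and `L e = 0`. -/
def IsPresentedBy (Φ : M →ₛₗ[(qShift q : ConvLaurent →+* ConvLaurent)] M) {m : ℕ}
    (a : Fin (m + 1) → ConvLaurent) : Prop :=
  a (Fin.last m) = 1 ∧ a 0 ≠ 0 ∧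
    ∃ e : M, LinearIndependent ConvLaurent (fun i : Fin m => Φ^[i] e) ∧
      Submodule.span ConvLaurent (Set.range fun i : Fin m => Φ^[i] e) = ⊤ ∧
      ∑ i : Fin (m + 1), a i • Φ^[i] e = 0

/-- `(M, Φ)` is pure of slope `lam`: the Newton polygon of an operator presenting `M` has `lam` as
its only slope. The zero module has no slope and is not pure. -/
def IsPure (Φ : M →ₛₗ[(qShift q : ConvLaurent →+* ConvLaurent)] M) (lam : ℚ) : Prop :=
  ∃ (m : ℕ) (a : Fin (m + 1) → ConvLaurent), IsPresentedBy Φ a ∧ newtonSlopes a = {lam}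

/-- Difference submodules: subspaces stable under `Φ` and under `Φ⁻¹`. -/
def IsStable (Φ : M →ₛₗ[(qShift q : ConvLaurent →+* ConvLaurent)] M)
    (N : Submodule ConvLaurent M) : Prop :=
  ∀ x, Φ x ∈ N ↔ x ∈ N

/-- The map that `Φ` induces on the quotient `N₂ / N₁` of difference submodules `N₁ ⊆ N₂`. -/
noncomputable def subquotient (Φ : M →ₛₗ[(qShift q : ConvLaurent →+* ConvLaurent)] M)
    (N₁ N₂ : Submodule ConvLaurent M) (h₁ : IsStable Φ N₁) (h₂ : IsStable Φ N₂) :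
    (N₂ ⧸ N₁.submoduleOf N₂) →ₛₗ[(qShift q : ConvLaurent →+* ConvLaurent)]
      (N₂ ⧸ N₁.submoduleOf N₂) :=
  Submodule.mapQ (N₁.submoduleOf N₂) (N₁.submoduleOf N₂)
    (Φ.restrict fun x hx => (h₂ x).2 hx) fun x hx => (h₁ x).2 hx

/-- `0 = N 0 ⊂ N 1 ⊂ ⋯ ⊂ N r = M` is a tower of difference submodules whose successive quotients
are pure of slopes `lam 0 < ⋯ < lam (r - 1)`. -/
structure IsSlopeFiltration (Φ : M →ₛₗ[(qShift q : ConvLaurent →+* ConvLaurent)] M) {r : ℕ}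
    (N : Fin (r + 1) → Submodule ConvLaurent M) (lam : Fin r → ℚ) : Prop where
  stable : ∀ i, IsStable Φ (N i)
  bot : N 0 = ⊥
  top : N (Fin.last r) = ⊤
  strictMono : StrictMono N
  pure : ∀ i : Fin r, IsPure
    (subquotient Φ (N i.castSucc) (N i.succ) (stable i.castSucc) (stable i.succ)) (lam i)
  slopes_strictMono : StrictMono lam

end Modules

end QDiff

namespace QDiff

open HahnSeries
open scoped ENNReal

/-! Existence. A cyclic vector `e` presents `M` as `K[Φ, Φ⁻¹] / K[Φ, Φ⁻¹] L`
(`exists_linearIndependent_iterate`). Let `lam` be the largest slope of `L`, that of the leftmost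
edge of its Newton polygon. Then `L = A * B` with `B` pure of slope `lam` and all slopes of `A`
smaller (`exists_factorization`). The vector `f = B e` is killed by `A` and generates a submodule on
which induction applies, and the quotient by it is presented by `B`. Hence small slopes come first.

The analytic content is the convergence of the factors. The coefficients of `A` and `B`, suitably
normalized, solve a quadratic equation `γ + Q γ = ε` (`exists_factor_series`). For weights adapted
to the polygon, `Q` raises orders by some `δ > 0`, so the iteration `γ ↦ ε - Q γ` converges
formally. Since `|q| < 1`, the substitutions `z ↦ q ^ i z` in `Q` cost only a constant in weighted
`ℓ¹` norms, and the gain `r ^ δ` beats it for small radii `r`. Thus the iterates stay in a fixed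
ball and the formal solution converges.

Uniqueness. There is no nonzero morphism between pure modules of different slopes. On a pure module
of slope `lam`, `Φ` shifts a filtration by lattices by exactly `lam`, so in an operator of another
slope a single extreme term dominates, which makes it injective (`IsPure.eq_zero_of_sum_eq_zero`).
Comparing two towers step by step then gives inclusions in both directions
(`le_of_forall_slope_ne`). -/

/-- All coefficients of `f` in degrees below `c` vanish. -/
def OrdGE (f : LaurentSeries ℂ) (c : ℚ) : Prop :=
  ∀ n : ℤ, (n : ℚ) < c → f.coeff n = 0

/-! ### Lower bounds on orders and formal limits -/

namespace OrdGE

variable {f g : LaurentSeries ℂ} {c d : ℚ}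

theorem zero : OrdGE 0 c := fun _ _ => rfl

theorem mono (hf : OrdGE f c) (h : d ≤ c) : OrdGE f d :=
  fun n hn => hf n (hn.trans_le h)

theorem add (hf : OrdGE f c) (hg : OrdGE g c) : OrdGE (f + g) c := fun n hn => by
  simp [hf n hn, hg n hn]

theorem neg (hf : OrdGE f c) : OrdGE (-f) c := fun n hn => by
  simp [hf n hn]

theorem sub (hf : OrdGE f c) (hg : OrdGE g c) : OrdGE (f - g) c := fun n hn => by
  simp [hf n hn, hg n hn]

theorem sum {ι : Type*} {s : Finset ι} {f : ι → LaurentSeries ℂ}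
    (h : ∀ i ∈ s, OrdGE (f i) c) : OrdGE (∑ i ∈ s, f i) c := by
  classical
  induction s using Finset.induction_on with
  | empty => simpa using zero
  | insert a s ha ih =>
    rw [Finset.sum_insert ha]
    exact (h a (by simp)).add (ih fun i hi => h i (by simp [hi]))

theorem mul (hf : OrdGE f c) (hg : OrdGE g d) : OrdGE (f * g) (c + d) := fun n hn => by
  rw [coeff_mul]
  refine Finset.sum_eq_zero fun x hx => ?_
  have hx' : x.1 + x.2 = n := (Finset.mem_antidiagonal.1 hx).2.2
  by_cases h1 : (x.1 : ℚ) < c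
  · rw [hf _ h1, zero_mul]
  · rw [hg, mul_zero]
    rw [← hx'] at hn
    push_cast at hn
    linarith

theorem dilate (hf : OrdGE f c) (q : ℂˣ) : OrdGE (dilate q f) c := fun n hn => by
  simp [dilate_coeff, hf n hn]

theorem le_order (hf : OrdGE f c) (h0 : f ≠ 0) : c ≤ f.order := by
  by_contra! h
  exact coeff_order_eq_zero.not.2 h0 (hf _ h)

theorem of_le_order (h : f ≠ 0 → c ≤ f.order) : OrdGE f c := fun n hn => by
  by_cases h0 : f = 0
  · simp [h0]
  · exact coeff_eq_zero_of_lt_order (by exact_mod_cast hn.trans_le (h h0))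

theorem eq_zero (h : ∀ c, OrdGE f c) : f = 0 := by
  ext n
  exact h (n + 1) n (by linarith)

end OrdGE

/-- The coefficient in degree `n` no longer changes once `c + s * δ` exceeds `n`, and the limit
takes it from such a stage. The common bound `c` keeps the support bounded below. -/
theorem exists_formal_limit {f : ℕ → LaurentSeries ℂ} {c δ : ℚ} (hδ : 0 < δ)
    (h0 : OrdGE (f 0) c) (h : ∀ s, OrdGE (f (s + 1) - f s) (c + s * δ)) :
    ∃ g : LaurentSeries ℂ, ∀ s, OrdGE (g - f s) (c + s * δ) := by
  have hstep : ∀ s t, OrdGE (f (s + t) - f s) (c + s * δ) := by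
    intro s t
    induction t with
    | zero => simpa using OrdGE.zero
    | succ t ih =>
      have h1 : f (s + (t + 1)) - f s = (f (s + t + 1) - f (s + t)) + (f (s + t) - f s) := by
        rw [← add_assoc]; ring
      rw [h1]
      refine ((h (s + t)).mono ?_).add ih
      push_cast
      nlinarith [mul_nonneg (Nat.cast_nonneg (α := ℚ) t) hδ.le]
  have hall : ∀ s, OrdGE (f s) c := fun s => by
    have := (hstep 0 s).mono (d := c) (by simp)
    simpa using this.add h0
  choose S hS using fun n : ℤ => exists_nat_gt (((n : ℚ) - c) / δ)
  have hS' : ∀ n : ℤ, (n : ℚ) < c + S n * δ := fun n => by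
    have := hS n
    rw [div_lt_iff₀ hδ] at this
    linarith
  have hcoeff : ∀ (n : ℤ) (s : ℕ), (n : ℚ) < c + s * δ →
      (f (S n)).coeff n = (f s).coeff n := by
    intro n s hs
    rcases le_total s (S n) with hle | hle
    · obtain ⟨t, ht⟩ := Nat.exists_eq_add_of_le hle
      have := hstep s t n hs
      rw [← ht, coeff_sub, sub_eq_zero] at this
      exact this
    · obtain ⟨t, ht⟩ := Nat.exists_eq_add_of_le hle
      have := hstep (S n) t n (hS' n)
      rw [← ht, coeff_sub, sub_eq_zero] at this
      exact this.symm
  refine ⟨ofSuppBddBelow (fun n => (f (S n)).coeff n) ⟨⌊c⌋, fun n hn => ?_⟩, fun s n hn => ?_⟩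
  · by_contra! hlt
    refine hn (hall _ n ?_)
    exact (Int.cast_lt.2 hlt).trans_le (Int.floor_le c)
  · rw [coeff_sub, sub_eq_zero]
    exact hcoeff n s hn

/-! ### Weighted norms and convergence -/

/-- The weight `r ^ c` of degree `c`, as an extended nonnegative real. -/
noncomputable def radiusPow (r : ℝ) (c : ℝ) : ℝ≥0∞ := ENNReal.ofReal (r ^ c)

theorem radiusPow_add {r : ℝ} (hr : 0 < r) (a b : ℝ) :
    radiusPow r (a + b) = radiusPow r a * radiusPow r b := by
  rw [radiusPow, Real.rpow_add hr, ENNReal.ofReal_mul (by positivity)]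
  rfl

theorem radiusPow_le {r : ℝ} (hr : 0 < r) (hr1 : r ≤ 1) {a b : ℝ} (h : a ≤ b) :
    radiusPow r b ≤ radiusPow r a :=
  ENNReal.ofReal_le_ofReal (Real.rpow_le_rpow_of_exponent_ge hr hr1 h)

/-- The weighted `ℓ¹` norm `∑ |fₙ| r ^ n`. -/
noncomputable def weightedNorm (r : ℝ) (f : LaurentSeries ℂ) : ℝ≥0∞ :=
  ∑' n : ℤ, ‖f.coeff n‖ₑ * radiusPow r n

theorem weightedNorm_zero (r : ℝ) : weightedNorm r 0 = 0 := by
  simp [weightedNorm]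

theorem weightedNorm_sub_le (r : ℝ) (f g : LaurentSeries ℂ) :
    weightedNorm r (f - g) ≤ weightedNorm r f + weightedNorm r g := by
  rw [weightedNorm, weightedNorm, weightedNorm, ← ENNReal.tsum_add]
  refine ENNReal.tsum_le_tsum fun n => ?_
  rw [← add_mul, coeff_sub]
  gcongr
  exact enorm_sub_le

theorem weightedNorm_add_le (r : ℝ) (f g : LaurentSeries ℂ) :
    weightedNorm r (f + g) ≤ weightedNorm r f + weightedNorm r g := by
  rw [weightedNorm, weightedNorm, weightedNorm, ← ENNReal.tsum_add]
  refine ENNReal.tsum_le_tsum fun n => ?_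
  rw [← add_mul, coeff_add]
  gcongr
  exact enorm_add_le _ _

theorem weightedNorm_sum_le (r : ℝ) {ι : Type*} (s : Finset ι) (f : ι → LaurentSeries ℂ) :
    weightedNorm r (∑ i ∈ s, f i) ≤ ∑ i ∈ s, weightedNorm r (f i) := by
  classical
  induction s using Finset.induction_on with
  | empty => simp [weightedNorm_zero]
  | insert a s ha ih =>
    rw [Finset.sum_insert ha, Finset.sum_insert ha]
    exact (weightedNorm_add_le r _ _).trans (by gcongr)

theorem weightedNorm_mul_le {r : ℝ} (hr : 0 < r) (f g : LaurentSeries ℂ) :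
    weightedNorm r (f * g) ≤ weightedNorm r f * weightedNorm r g := by
  have key : ∀ n : ℤ, ‖(f * g).coeff n‖ₑ * radiusPow r n ≤
      ∑' a : ℤ, (‖f.coeff a‖ₑ * radiusPow r a) *
        (‖g.coeff (n - a)‖ₑ * radiusPow r ((n - a : ℤ) : ℝ)) := by
    intro n
    have hw : ∀ a : ℤ, radiusPow r n = radiusPow r a * radiusPow r ((n - a : ℤ) : ℝ) :=
      fun a => by rw [← radiusPow_add hr]; congr 1; push_cast; ring
    calc ‖(f * g).coeff n‖ₑ * radiusPow r n
        ≤ (∑ x ∈ Finset.antidiagonal f.isPWO_support g.isPWO_support n,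
            ‖f.coeff x.1‖ₑ * ‖g.coeff x.2‖ₑ) * radiusPow r n := by
          gcongr
          rw [coeff_mul]
          refine (enorm_sum_le _ _).trans (le_of_eq ?_)
          exact Finset.sum_congr rfl fun x _ => enorm_mul _ _
      _ = ∑ a ∈ (Finset.antidiagonal f.isPWO_support g.isPWO_support n).image Prod.fst,
            (‖f.coeff a‖ₑ * radiusPow r a) *
              (‖g.coeff (n - a)‖ₑ * radiusPow r ((n - a : ℤ) : ℝ)) := by
          rw [Finset.sum_image, Finset.sum_mul]
          · refine Finset.sum_congr rfl fun x hx => ?_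
            have hx' : x.1 + x.2 = n := (Finset.mem_antidiagonal.1 hx).2.2
            have hx2 : x.2 = n - x.1 := by omega
            rw [hw x.1, ← hx2]
            ring
          · intro x hx y hy hxy
            have hx' : x.1 + x.2 = n := (Finset.mem_antidiagonal.1 hx).2.2
            have hy' : y.1 + y.2 = n := (Finset.mem_antidiagonal.1 hy).2.2
            exact Prod.ext hxy (by omega)
      _ ≤ _ := ENNReal.sum_le_tsum _
  calc weightedNorm r (f * g) ≤ _ := ENNReal.tsum_le_tsum key
    _ = ∑' a : ℤ, ∑' n : ℤ, (‖f.coeff a‖ₑ * radiusPow r a) *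
        (‖g.coeff (n - a)‖ₑ * radiusPow r ((n - a : ℤ) : ℝ)) := ENNReal.tsum_comm
    _ = ∑' a : ℤ, (‖f.coeff a‖ₑ * radiusPow r a) * weightedNorm r g := by
        refine tsum_congr fun a => ?_
        rw [ENNReal.tsum_mul_left, weightedNorm]
        congr 1
        exact (Equiv.subRight a).tsum_eq fun b : ℤ => ‖g.coeff b‖ₑ * radiusPow r (b : ℝ)
    _ = _ := ENNReal.tsum_mul_right

/-- Convergence depends on `|q| < 1` here: dilation does not increase the terms of degree `n ≥ 0`,
and those with `-d ≤ n < 0` grow at most by `|q| ^ (-m d)`. The constant depends neither on `i ≤ m`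
nor on `r`. -/
theorem weightedNorm_dilate_le {q : ℂˣ} (hq : ‖(q : ℂ)‖ < 1) {m i : ℕ} (hi : i ≤ m) {d : ℕ}
    {f : LaurentSeries ℂ} (hf : OrdGE f (-(d : ℚ))) (r : ℝ) :
    weightedNorm r (dilate (q ^ i) f) ≤
      ENNReal.ofReal (‖(q : ℂ)‖⁻¹ ^ (m * d)) * weightedNorm r f := by
  rw [weightedNorm, weightedNorm, ← ENNReal.tsum_mul_left]
  refine ENNReal.tsum_le_tsum fun n => ?_
  by_cases hn : f.coeff n = 0
  · simp [dilate_coeff, hn]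
  have hn' : -(d : ℤ) ≤ n := by
    by_contra! h
    exact hn (hf n (by exact_mod_cast h))
  rw [dilate_coeff, enorm_mul, mul_assoc]
  gcongr
  rw [← ofReal_norm]
  refine ENNReal.ofReal_le_ofReal ?_
  have hq0 : 0 < ‖(q : ℂ)‖ := norm_pos_iff.2 q.ne_zero
  rw [norm_zpow, Units.val_pow_eq_pow_val, norm_pow, ← zpow_natCast, ← zpow_mul, inv_pow,
    ← zpow_natCast, ← zpow_neg]
  refine zpow_le_zpow_right_of_le_one₀ hq0 hq.le ?_
  have h1 : (i : ℤ) ≤ m := by exact_mod_cast hi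
  push_cast
  nlinarith [mul_nonneg (Nat.cast_nonneg (α := ℤ) i) (by omega : 0 ≤ n + d),
    mul_nonneg (Nat.cast_nonneg (α := ℤ) d) (by omega : (0 : ℤ) ≤ m - i)]

theorem isConvergent_of_weightedNorm_ne_top {r : ℝ} (hr : 0 < r) {f : LaurentSeries ℂ}
    (h : weightedNorm r f ≠ ∞) : IsConvergent f := by
  refine ⟨r, hr, (ENNReal.summable_toReal h).congr fun n => ?_⟩
  rw [radiusPow, ENNReal.toReal_mul, toReal_enorm, ENNReal.toReal_ofReal (by positivity),
    Real.rpow_intCast]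

/-- If the norm is finite at radius `s`, then for `r < s` every exponent `n ≥ c` satisfies `(r / s)
^ n ≤ (r / s) ^ c`. -/
theorem IsConvergent.exists_weightedNorm_le {f : LaurentSeries ℂ} (hf : IsConvergent f) {c : ℚ}
    (hc : OrdGE f c) : ∃ C : ℝ≥0∞, C ≠ ∞ ∧
      ∀ᶠ r in nhdsWithin (0 : ℝ) (Set.Ioi 0), weightedNorm r f ≤ C * radiusPow r c := by
  obtain ⟨s, hs, hsum⟩ := hf
  have hfin : weightedNorm s f ≠ ∞ := by
    have h1 := hsum.tsum_ofReal_ne_top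
    convert h1 using 1
    refine tsum_congr fun n => ?_
    rw [ENNReal.ofReal_mul (norm_nonneg _), ofReal_norm, radiusPow, Real.rpow_intCast]
  refine ⟨weightedNorm s f * radiusPow s (-c), ENNReal.mul_ne_top hfin ENNReal.ofReal_ne_top, ?_⟩
  filter_upwards [Ioo_mem_nhdsGT hs] with r hr
  rw [weightedNorm, weightedNorm, mul_assoc, ← ENNReal.tsum_mul_right]
  refine ENNReal.tsum_le_tsum fun n => ?_
  by_cases hn : f.coeff n = 0
  · simp [hn]
  have hn' : (c : ℝ) ≤ n := by
    by_contra! h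
    exact hn (hc n (by exact_mod_cast h))
  rw [mul_assoc]
  gcongr
  rw [radiusPow, radiusPow, radiusPow, radiusPow, ← ENNReal.ofReal_mul (by positivity),
    ← ENNReal.ofReal_mul (by positivity)]
  refine ENNReal.ofReal_le_ofReal ?_
  have h1 : (r / s) ^ (n : ℝ) ≤ (r / s) ^ (c : ℝ) :=
    Real.rpow_le_rpow_of_exponent_ge (div_pos hr.1 hs) ((div_le_one hs).2 hr.2.le) hn'
  rw [Real.div_rpow hr.1.le hs.le, Real.div_rpow hr.1.le hs.le,
    div_le_iff₀ (by positivity)] at h1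
  rw [Real.rpow_neg hs.le]
  refine h1.trans (le_of_eq ?_)
  field_simp

/-- A Fatou argument: each finite partial sum for `g` is a partial sum for some `f s`. It passes
norm bounds to a formal limit without convergence in norm. -/
theorem weightedNorm_le_of_forall_coeff {r : ℝ} {f : ℕ → LaurentSeries ℂ} {g : LaurentSeries ℂ}
    {B : ℝ≥0∞} (hB : ∀ s, weightedNorm r (f s) ≤ B)
    (h : ∀ N : ℤ, ∃ s, ∀ n ≤ N, g.coeff n = (f s).coeff n) : weightedNorm r g ≤ B := by
  rw [weightedNorm, ENNReal.tsum_eq_iSup_sum]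
  refine iSup_le fun T => ?_
  obtain ⟨N, hN⟩ := T.bddAbove
  obtain ⟨s, hs⟩ := h N
  refine le_trans (le_of_eq ?_) ((ENNReal.sum_le_tsum T).trans (hB s))
  exact Finset.sum_congr rfl fun n hn => by rw [hs n (hN hn)]

/-! ### The quadratic equation for the factors -/

/-- The quadratic part `∑_{i + j = n, j < k} γ_{i + k} φ ^ i (γ_j)` of the coefficient of `Φ ^ n`
in `(1 + ∑ γ_{i + k} Φ ^ i) (Φ ^ k + ∑_{j < k} γ_j Φ ^ j)`. -/
noncomputable def factorQuad (q : ℂˣ) (k : ℕ) (γ : ℕ → LaurentSeries ℂ) (n : ℕ) :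
    LaurentSeries ℂ :=
  ∑ x ∈ (Finset.HasAntidiagonal.antidiagonal n).filter (fun x => x.2 < k),
    γ (x.1 + k) * dilate (q ^ x.1) (γ x.2)

theorem dilate_sub (q : ℂˣ) (f g : LaurentSeries ℂ) :
    dilate q (f - g) = dilate q f - dilate q g := by
  ext n
  simp [dilate_coeff, mul_sub]

theorem factorQuad_eq_zero {q : ℂˣ} {k m n : ℕ} {γ : ℕ → LaurentSeries ℂ}
    (h : ∀ n, m < n → γ n = 0) (hn : m < n) : factorQuad q k γ n = 0 := by
  refine Finset.sum_eq_zero fun x hx => ?_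
  rw [Finset.mem_filter, Finset.HasAntidiagonal.mem_antidiagonal] at hx
  rw [h _ (by omega), zero_mul]

section

variable {q : ℂˣ} {k : ℕ} {c : ℕ → ℚ} {δ : ℚ}

theorem OrdGE.factorQuad (hδ : 0 < δ) (hc : ∀ i j, j < k → c (i + j) + δ ≤ c (i + k) + c j)
    {γ : ℕ → LaurentSeries ℂ} (h : ∀ n, OrdGE (γ n) (c n)) (n : ℕ) :
    OrdGE (factorQuad q k γ n) (c n) := by
  refine OrdGE.sum fun x hx => ?_
  rw [Finset.mem_filter, Finset.HasAntidiagonal.mem_antidiagonal] at hx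
  refine ((h _).mul ((h _).dilate _)).mono ?_
  rw [← hx.1]
  linarith [hc x.1 x.2 hx.2]

/-- The formal contraction: in each product one factor is replaced at a time, and the hypothesis
`hc` on the weights contributes the extra `δ`. -/
theorem OrdGE.factorQuad_sub
    (hc : ∀ i j, j < k → c (i + j) + δ ≤ c (i + k) + c j)
    {γ γ' : ℕ → LaurentSeries ℂ} (h : ∀ n, OrdGE (γ n) (c n)) (h' : ∀ n, OrdGE (γ' n) (c n))
    {D : ℚ} (hD : ∀ n, OrdGE (γ n - γ' n) (c n + D)) (n : ℕ) :
    OrdGE (QDiff.factorQuad q k γ n - QDiff.factorQuad q k γ' n) (c n + (D + δ)) := by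
  rw [QDiff.factorQuad, QDiff.factorQuad, ← Finset.sum_sub_distrib]
  refine OrdGE.sum fun x hx => ?_
  rw [Finset.mem_filter, Finset.HasAntidiagonal.mem_antidiagonal] at hx
  have h1 : γ (x.1 + k) * QDiff.dilate (q ^ x.1) (γ x.2) -
      γ' (x.1 + k) * QDiff.dilate (q ^ x.1) (γ' x.2) =
      (γ (x.1 + k) - γ' (x.1 + k)) * QDiff.dilate (q ^ x.1) (γ x.2) +
      γ' (x.1 + k) * QDiff.dilate (q ^ x.1) (γ x.2 - γ' x.2) := by
    rw [dilate_sub]; ring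
  have h2 := hc x.1 x.2 hx.2
  rw [h1, ← hx.1]
  exact (((hD _).mul ((h _).dilate _)).mono (by linarith)).add
    (((h' _).mul ((hD _).dilate _)).mono (by linarith))

theorem weightedNorm_factorQuad_le (hq : ‖(q : ℂ)‖ < 1)
    (hc : ∀ i j, j < k → c (i + j) + δ ≤ c (i + k) + c j) {d m : ℕ}
    (hd : ∀ j < k, -(d : ℚ) ≤ c j) {r : ℝ} (hr : 0 < r) (hr1 : r ≤ 1) {B : ℝ≥0∞}
    {γ : ℕ → LaurentSeries ℂ} (h0 : ∀ n, m < n → γ n = 0) (h : ∀ n, OrdGE (γ n) (c n))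
    (hB : ∀ n, weightedNorm r (γ n) ≤ B * radiusPow r (c n)) (n : ℕ) :
    weightedNorm r (factorQuad q k γ n) ≤
      k * (ENNReal.ofReal (‖(q : ℂ)‖⁻¹ ^ (m * d)) * B * B * radiusPow r δ) *
        radiusPow r (c n) := by
  set C := ENNReal.ofReal (‖(q : ℂ)‖⁻¹ ^ (m * d))
  -- A pair with `i + j = n` is determined by `j < k`, so the number of terms is bounded
  -- independently of `n`.
  have hcard : ((Finset.HasAntidiagonal.antidiagonal n).filter (fun x => x.2 < k)).card ≤ k := by
    rw [← Finset.card_range k]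
    refine Finset.card_le_card_of_injOn Prod.snd (fun x hx => ?_) fun x hx y hy hxy => ?_
    · rw [Finset.mem_coe, Finset.mem_filter] at hx
      simpa using hx.2
    · rw [Finset.mem_coe, Finset.mem_filter, Finset.HasAntidiagonal.mem_antidiagonal] at hx hy
      exact Prod.ext (by omega) hxy
  refine (weightedNorm_sum_le _ _ _).trans ?_
  refine (Finset.sum_le_card_nsmul _ _ ((C * B * B * radiusPow r δ) * radiusPow r (c n))
    fun x hx => ?_).trans ?_
  · rw [Finset.mem_filter, Finset.HasAntidiagonal.mem_antidiagonal] at hx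
    -- Terms with `i + k > m` vanish; the others have `i ≤ m`, as the uniform dilation bound
    -- requires.
    by_cases hx1 : m < x.1 + k
    · rw [h0 _ hx1, zero_mul, weightedNorm_zero]
      exact zero_le
    calc weightedNorm r (γ (x.1 + k) * dilate (q ^ x.1) (γ x.2))
        ≤ weightedNorm r (γ (x.1 + k)) * weightedNorm r (dilate (q ^ x.1) (γ x.2)) :=
          weightedNorm_mul_le hr _ _
      _ ≤ (B * radiusPow r (c (x.1 + k))) * (C * (B * radiusPow r (c x.2))) := by
          gcongr
          · exact hB _
          · refine (weightedNorm_dilate_le hq (m := m) (by omega) ((h x.2).mono (hd _ hx.2)) r).trans ?_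
            gcongr
            exact hB _
      _ = C * B * B * radiusPow r (c (x.1 + k) + c x.2) := by
          rw [radiusPow_add hr]; ring
      _ ≤ C * B * B * radiusPow r (c (x.1 + x.2) + δ) := by
          gcongr
          exact radiusPow_le hr hr1 (by exact_mod_cast hc x.1 x.2 hx.2)
      _ = _ := by
          rw [hx.1, radiusPow_add hr]; ring
  · rw [nsmul_eq_mul, mul_assoc (k : ℝ≥0∞)]
    gcongr

/-- Iteration of `γ ↦ ε - Q γ` from `0`. The formal contraction yields the limit and the equation;
an invariant ball in the weighted norms yields convergence. -/
theorem exists_factor_series (hq : ‖(q : ℂ)‖ < 1) (hδ : 0 < δ)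
    (hc : ∀ i j, j < k → c (i + j) + δ ≤ c (i + k) + c j) {m : ℕ}
    {ε : ℕ → LaurentSeries ℂ} (hε0 : ∀ n, m < n → ε n = 0) (hε : ∀ n, OrdGE (ε n) (c n))
    (hconv : ∀ n, IsConvergent (ε n)) :
    ∃ γ : ℕ → LaurentSeries ℂ, (∀ n, m < n → γ n = 0) ∧ (∀ n, OrdGE (γ n) (c n)) ∧
      (∀ n, IsConvergent (γ n)) ∧ ∀ n, γ n + factorQuad q k γ n = ε n := by
  let F : (ℕ → LaurentSeries ℂ) → ℕ → LaurentSeries ℂ := fun γ n => ε n - factorQuad q k γ n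
  let f : ℕ → ℕ → LaurentSeries ℂ := fun s => F^[s] 0
  have hf0 : f 0 = 0 := rfl
  have hfs : ∀ s, f (s + 1) = F (f s) := fun s => Function.iterate_succ_apply' F s 0
  have hz : ∀ s n, m < n → f s n = 0 := by
    intro s
    induction s with
    | zero => intro n _; rfl
    | succ s ih =>
      intro n hn
      rw [hfs]
      simp only [F]
      rw [hε0 n hn, factorQuad_eq_zero ih hn, sub_zero]
  have hord : ∀ s n, OrdGE (f s n) (c n) := by
    intro s
    induction s with
    | zero => intro n; exact OrdGE.zero
    | succ s ih =>
      intro n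
      rw [hfs]
      exact (hε n).sub (OrdGE.factorQuad hδ hc ih n)
  have hdiff : ∀ s n, OrdGE (f (s + 1) n - f s n) (c n + s * δ) := by
    intro s
    induction s with
    | zero =>
      intro n
      have := hord 1 n
      simpa [hf0] using this
    | succ s ih =>
      intro n
      have h1 := OrdGE.factorQuad_sub (q := q) hc (hord (s + 1)) (hord s) ih n
      have h2 : f (s + 1 + 1) n - f (s + 1) n =
          -(factorQuad q k (f (s + 1)) n - factorQuad q k (f s) n) := by
        have h3 : ∀ t, f (t + 1) n = ε n - factorQuad q k (f t) n := fun t => congrFun (hfs t) n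
        rw [h3 (s + 1), h3 s]
        ring
      rw [h2]
      exact h1.neg.mono (le_of_eq (by push_cast; ring))
  choose γ hγ using fun n => exists_formal_limit (f := fun s => f s n) hδ OrdGE.zero
    (fun s => hdiff s n)
  have hγord : ∀ n, OrdGE (γ n) (c n) := fun n => by
    have := hγ n 0
    simpa [hf0] using this
  have hγ0 : ∀ n, m < n → γ n = 0 := by
    intro n hn
    refine OrdGE.eq_zero fun b => ?_
    obtain ⟨s, hs⟩ := exists_nat_gt ((b - c n) / δ)
    rw [div_lt_iff₀ hδ] at hs
    have := hγ n s
    rw [hz s n hn, sub_zero] at this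
    exact this.mono (by linarith)
  refine ⟨γ, hγ0, hγord, fun n => ?_, fun n => ?_⟩
  · choose C hC hCle using fun n => (hconv n).exists_weightedNorm_le (hε n)
    obtain ⟨d, hd⟩ : ∃ d : ℕ, ∀ j < k, -(d : ℚ) ≤ c j := by
      obtain ⟨d, hd⟩ := exists_nat_ge (∑ j ∈ Finset.range k, |c j|)
      refine ⟨d, fun j hj => ?_⟩
      have h1 : |c j| ≤ ∑ j ∈ Finset.range k, |c j| :=
        Finset.single_le_sum (f := fun j => |c j|) (fun _ _ => abs_nonneg _)
          (Finset.mem_range.2 hj)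
      linarith [neg_abs_le (c j)]
    -- `A` bounds the weighted size of all `ε n` at once; the summand `1` makes it positive, so that
    -- it can dominate the vanishing quadratic term.
    set A : ℝ≥0∞ := 1 + ∑ n ∈ Finset.range (m + 1), C n with hA
    have hAtop : A ≠ ∞ := by
      rw [hA]
      exact ENNReal.add_ne_top.2 ⟨ENNReal.one_ne_top, ENNReal.sum_ne_top.2 fun n _ => hC n⟩
    set E := ENNReal.ofReal (‖(q : ℂ)‖⁻¹ ^ (m * d)) with hE
    have hsmall : ∀ᶠ r in nhdsWithin (0 : ℝ) (Set.Ioi 0),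
        k * (E * (2 * A) * (2 * A) * radiusPow r δ) ≤ A := by
      have ht : Filter.Tendsto (fun r : ℝ => (k * (E * (2 * A) * (2 * A))) * radiusPow r δ)
          (nhdsWithin (0 : ℝ) (Set.Ioi 0)) (nhds 0) := by
        have h1 : Filter.Tendsto (fun r : ℝ => r ^ (δ : ℝ)) (nhdsWithin (0 : ℝ) (Set.Ioi 0))
            (nhds 0) := by
          have := (Real.continuousAt_rpow_const 0 (δ : ℝ) (Or.inr (by exact_mod_cast hδ.le))).tendsto
          rw [Real.zero_rpow (by exact_mod_cast hδ.ne')] at this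
          exact this.mono_left nhdsWithin_le_nhds
        have h2 := ENNReal.tendsto_ofReal h1
        rw [ENNReal.ofReal_zero] at h2
        have h3 := ENNReal.Tendsto.const_mul (a := (k * (E * (2 * A) * (2 * A)))) h2
          (Or.inr (by finiteness))
        simpa [radiusPow] using h3
      have hA0 : 0 < A := lt_of_lt_of_le one_pos le_self_add
      filter_upwards [ht.eventually_lt_const hA0] with r hr
      refine le_trans (le_of_eq ?_) hr.le
      ring
    have hall : ∀ᶠ r in nhdsWithin (0 : ℝ) (Set.Ioi 0), ∀ n ∈ Finset.range (m + 1),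
        weightedNorm r (ε n) ≤ C n * radiusPow r (c n) :=
      (Filter.eventually_all_finset _).2 fun n _ => hCle n
    obtain ⟨r, ⟨hr0, hr1⟩, hrs, hrε⟩ :=
      ((Filter.Eventually.and (Ioo_mem_nhdsGT one_pos) (hsmall.and hall))).exists
    -- The ball of radius `2 * A` is invariant: `ε` contributes at most `A`, and the quadratic term
    -- at most `A` by the choice of `r`.
    have hball : ∀ s n, weightedNorm r (f s n) ≤ 2 * A * radiusPow r (c n) := by
      intro s
      induction s with
      | zero => intro n; rw [hf0]; simp [weightedNorm_zero]
      | succ s ih =>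
        intro n
        rw [hfs]
        have h1 : weightedNorm r (ε n) ≤ A * radiusPow r (c n) := by
          by_cases hn : m < n
          · rw [hε0 n hn, weightedNorm_zero]; exact zero_le
          · have hn' : n ∈ Finset.range (m + 1) := Finset.mem_range.2 (by omega)
            refine (hrε n hn').trans ?_
            gcongr
            exact (Finset.single_le_sum (f := C) (fun _ _ => zero_le) hn').trans le_add_self
        have h2 := weightedNorm_factorQuad_le hq hc hd hr0 hr1.le (hz s) (hord s) ih n
        calc weightedNorm r (ε n - factorQuad q k (f s) n)
            ≤ A * radiusPow r (c n) + A * radiusPow r (c n) := by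
              refine (weightedNorm_sub_le _ _ _).trans (add_le_add h1 (h2.trans ?_))
              gcongr
          _ = _ := by ring
    refine isConvergent_of_weightedNorm_ne_top hr0 (ne_top_of_le_ne_top
      (b := 2 * A * radiusPow r (c n)) ?_
      (weightedNorm_le_of_forall_coeff (fun s => hball s n) fun N => ?_))
    · exact ENNReal.mul_ne_top (by finiteness) ENNReal.ofReal_ne_top
    · obtain ⟨s, hs⟩ := exists_nat_gt ((N - c n) / δ)
      rw [div_lt_iff₀ hδ] at hs
      refine ⟨s, fun j hj => ?_⟩
      have hjN : (j : ℚ) ≤ N := by exact_mod_cast hj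
      have := hγ n s j (by linarith)
      rwa [coeff_sub, sub_eq_zero] at this
  · rw [← sub_eq_zero]
    refine OrdGE.eq_zero fun b => ?_
    obtain ⟨s, hs⟩ := exists_nat_gt ((b - c n) / δ)
    rw [div_lt_iff₀ hδ] at hs
    have h1 := hγ n (s + 1)
    have h2 := OrdGE.factorQuad_sub (q := q) hc hγord (hord s) (fun n => hγ n s) n
    -- Since `f (s + 1) = ε - Q (f s)`, the defect is a sum of two differences whose orders tend to
    -- infinity with `s`.
    have h3 : γ n + factorQuad q k γ n - ε n =
        (γ n - f (s + 1) n) + (factorQuad q k γ n - factorQuad q k (f s) n) := by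
      rw [hfs]; simp only [F]; ring
    rw [h3]
    exact (h1.mono (by push_cast; linarith)).add (h2.mono (by linarith))

end

/-! ### Cyclic vectors -/

/-- `A (x + c • y)` is a polynomial in `c` with infinitely many zeros, and the derivative is its
coefficient in degree one. -/
theorem linearDeriv_eq_zero_of_infinite {K ι V : Type*} [Field K] [Fintype ι] [DecidableEq ι]
    [AddCommGroup V] [Module K V] (A : MultilinearMap K (fun _ : ι => V) K) (x y : ι → V)
    {S : Set K} (hS : S.Infinite) (h : ∀ c ∈ S, A (x + c • y) = 0) :
    A.linearDeriv x y = 0 := by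
  let P : Polynomial K := Polynomial.C (A x) + Polynomial.C (A.linearDeriv x y) * Polynomial.X +
    ∑ s : Finset ι with 2 ≤ s.card, Polynomial.C (A (s.piecewise y x)) * Polynomial.X ^ s.card
  have hP : P = 0 := by
    refine Polynomial.eq_zero_of_infinite_isRoot P (hS.mono fun c hc => ?_)
    have h1 := h c hc
    rw [A.map_add_eq_map_add_linearDeriv_add] at h1
    rw [Set.mem_ofPred_eq, Polynomial.IsRoot.def, ← h1]
    simp only [P, Polynomial.eval_add, Polynomial.eval_C, Polynomial.eval_mul, Polynomial.eval_X,
      Polynomial.eval_finsetSum, Polynomial.eval_pow, map_smul, smul_eq_mul, mul_comm c]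
    congr 1
    refine Finset.sum_congr rfl fun s _ => ?_
    have h2 : s.piecewise (c • y) x =
        s.piecewise (fun i => c • s.piecewise y x i) (s.piecewise y x) := by
      ext i
      by_cases hi : i ∈ s <;> simp [hi]
    rw [h2, A.map_piecewise_smul (fun _ => c), Finset.prod_const, smul_eq_mul, mul_comm]
  have h3 : P.coeff 1 = A.linearDeriv x y := by
    simp only [P, Polynomial.coeff_add, Polynomial.finsetSum_coeff, Polynomial.coeff_C_mul,
      Polynomial.coeff_X_pow, Polynomial.coeff_X_one]
    rw [Finset.sum_eq_zero]
    · simp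
    · intro s hs
      rw [Finset.mem_filter] at hs
      rw [if_neg (by omega), mul_zero]
  rw [← h3, hP, Polynomial.coeff_zero]

theorem exists_alternatingMap_apply_eq_one {K V : Type*} [Field K] [AddCommGroup V] [Module K V]
    {n : ℕ} {v : Fin n → V} (hv : LinearIndependent K v) :
    ∃ A : V [⋀^Fin n]→ₗ[K] K, A v = 1 := by
  obtain ⟨g, hg⟩ := LinearMap.exists_leftInverse_of_injective (Fintype.linearCombination K v)
    (LinearMap.ker_eq_bot.2 hv.fintypeLinearCombination_injective)
  refine ⟨(Matrix.detRowAlternating (n := Fin n) (R := K)).compLinearMap g, ?_⟩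
  have h1 : ∀ i, g (v i) = (1 : Matrix (Fin n) (Fin n) K) i := fun i => by
    have := LinearMap.congr_fun hg (Pi.single i 1)
    simp only [LinearMap.comp_apply, Fintype.linearCombination_apply_single, one_smul,
      LinearMap.id_apply] at this
    rw [this]
    ext j
    simp [Matrix.one_apply, Pi.single_apply, eq_comm]
  rw [AlternatingMap.compLinearMap_apply]
  have h2 : (fun i => g (v i)) = (1 : Matrix (Fin n) (Fin n) K) := funext h1
  rw [h2]
  exact Matrix.det_one

/-- The monomial `c z ^ k` in `K`. -/
noncomputable def monomial (k : ℤ) (c : ℂ) : ConvLaurent := ⟨single k c, isConvergent_single k c⟩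

theorem monomial_mul (k l : ℤ) (c d : ℂ) :
    monomial k c * monomial l d = monomial (k + l) (c * d) :=
  Subtype.ext single_mul_single

theorem monomial_injective (k : ℤ) : Function.Injective (monomial k) := fun _ _ h =>
  single_injective k (congrArg Subtype.val h)

theorem monomial_zero_pow (c : ℂ) (n : ℕ) : monomial 0 c ^ n = monomial 0 (c ^ n) := by
  induction n with
  | zero => rfl
  | succ n ih => rw [pow_succ, ih, monomial_mul, pow_succ, add_zero]

theorem qShift_monomial (q : ℂˣ) (k : ℤ) (c : ℂ) :
    qShift q (monomial k c) = monomial k ((q : ℂ) ^ k * c) := by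
  refine Subtype.ext (HahnSeries.ext (funext fun n => ?_))
  change (q : ℂ) ^ n * (single k c).coeff n = (single k ((q : ℂ) ^ k * c)).coeff n
  by_cases h : n = k
  · subst h; simp
  · simp [coeff_single_of_ne h]

theorem qShift_qShift (p q : ℂˣ) (f : ConvLaurent) :
    qShift p (qShift q f) = qShift (p * q) f :=
  Subtype.ext (dilate_dilate p q f)

theorem qShift_one (f : ConvLaurent) : qShift 1 f = f :=
  Subtype.ext (dilate_one f)

section

variable {q : ℂˣ} {M : Type*} [AddCommGroup M] [Module ConvLaurent M]
  (Φ : M →ₛₗ[(qShift q : ConvLaurent →+* ConvLaurent)] M)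

theorem map_smul_qShift (c : ConvLaurent) (x : M) : Φ (c • x) = qShift q c • Φ x :=
  Φ.map_smulₛₗ c x

theorem iterate_smul (i : ℕ) (c : ConvLaurent) (x : M) :
    Φ^[i] (c • x) = qShift (q ^ i) c • Φ^[i] x := by
  induction i with
  | zero => simp [qShift_one]
  | succ i ih =>
    rw [Function.iterate_succ_apply', ih, map_smul_qShift, qShift_qShift, ← pow_succ',
      ← Function.iterate_succ_apply' Φ]

theorem iterate_sum {ι : Type*} (i : ℕ) (s : Finset ι) (f : ι → M) :
    Φ^[i] (∑ j ∈ s, f j) = ∑ j ∈ s, Φ^[i] (f j) := by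
  induction i with
  | zero => rfl
  | succ i ih =>
    rw [Function.iterate_succ_apply', ih, map_sum]
    exact Finset.sum_congr rfl fun j _ => (Function.iterate_succ_apply' Φ i _).symm

/-- The family of the first `d + 1` iterates of `e + t f` depends on `t` polynomially. If all its
members with `t = c z ^ k` are linearly dependent, then so is the family
`e, …, Φ ^ (d - 1) e, Φ ^ d f`. -/
theorem iterate_mem_span_of_forall_not_linearIndependent (hq : ‖(q : ℂ)‖ < 1) {d : ℕ} {e : M}
    (he : LinearIndependent ConvLaurent fun i : Fin d => Φ^[i] e)
    (hdep : ∀ e' : M, ¬ LinearIndependent ConvLaurent fun i : Fin (d + 1) => Φ^[i] e') (f : M) :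
    Φ^[d] f ∈ Submodule.span ConvLaurent (Set.range fun i : Fin d => Φ^[i] e) := by
  by_contra hf
  let x : Fin (d + 1) → M := fun i => Φ^[i] e
  have hx : LinearIndependent ConvLaurent (Function.update x (Fin.last d) (Φ^[d] f)) := by
    rw [linearIndependent_finSucc']
    have h1 : Fin.init (Function.update x (Fin.last d) (Φ^[d] f)) = fun i : Fin d => Φ^[i] e := by
      ext i
      simp [Fin.init, x]
    rw [h1]
    exact ⟨he, by simpa using hf⟩
  obtain ⟨A, hA⟩ := exists_alternatingMap_apply_eq_one hx
  -- With `k` fixed and `c` varying over `ℂ`, the determinant `A` of the iterates of `e + c z ^ k f`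
  -- vanishes identically, hence so does its linear term in `c`.
  have hsum : ∀ k : ℕ, A.toMultilinearMap.linearDeriv x
      (fun i => qShift (q ^ (i : ℕ)) (monomial k 1) • Φ^[i] f) = 0 := by
    intro k
    refine linearDeriv_eq_zero_of_infinite _ _ _ (S := Set.range (monomial 0))
      (Set.infinite_range_of_injective (monomial_injective 0)) ?_
    rintro _ ⟨c, rfl⟩
    refine A.map_linearDependent _ ?_
    have hfam : (x + monomial 0 c • fun i : Fin (d + 1) =>
        qShift (q ^ (i : ℕ)) (monomial k 1) • Φ^[i] f) =
        fun i : Fin (d + 1) => Φ^[i] (e + monomial k c • f) := ?_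
    · rw [hfam]
      exact hdep _
    ext i
    rw [iterate_map_add, iterate_smul, Pi.add_apply, Pi.smul_apply, smul_smul]
    congr 2
    rw [qShift_monomial, qShift_monomial, monomial_mul]
    congr 1
    · simp
    · ring
  -- The linear terms read `∑ᵢ q ^ (i k) Aᵢ = 0` for every `k`. The powers `q ^ i` are distinct, so
  -- Vandermonde gives `Aᵢ = 0` for all `i`; but the last one is `1`.
  have hzero := Matrix.eq_zero_of_forall_pow_sum_mul_pow_eq_zero
    (f := fun i : Fin (d + 1) => monomial 0 ((q : ℂ) ^ (i : ℕ)))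
    (v := fun i : Fin (d + 1) => A (Function.update x i (Φ^[i] f))) ?_ ?_
  · have := congrFun hzero (Fin.last d)
    simp only [Fin.val_last, Pi.zero_apply] at this
    rw [this] at hA
    exact zero_ne_one hA
  · intro i j hij
    have h1 := congrArg norm (monomial_injective 0 hij)
    rw [norm_pow, norm_pow] at h1
    exact Fin.ext (pow_right_injective₀ (norm_pos_iff.2 q.ne_zero) hq.ne h1)
  · intro k
    have h1 := hsum k
    rw [MultilinearMap.linearDeriv_apply] at h1
    have h2 : monomial k 1 * ∑ j : Fin (d + 1), A (Function.update x j (Φ^[j] f)) *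
        monomial 0 ((q : ℂ) ^ (j : ℕ)) ^ (k : ℕ) = 0 := by
      rw [← h1, Finset.mul_sum]
      refine Finset.sum_congr rfl fun i _ => ?_
      rw [MultilinearMap.map_update_smul, smul_eq_mul, monomial_zero_pow, qShift_monomial,
        mul_left_comm, monomial_mul, mul_comm]
      congr 2
      simp
    refine (mul_eq_zero.1 h2).resolve_left fun h => ?_
    exact one_ne_zero (monomial_injective k (h.trans (Subtype.ext (by simp [monomial]))))

/-- If `d` independent iterates could never be extended to `d + 1`, the span of the first `d` would
contain the image of `Φ ^ d`. That image is all of `M` by surjectivity, against the dimension. -/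
theorem exists_linearIndependent_iterate [FiniteDimensional ConvLaurent M]
    (hq : ‖(q : ℂ)‖ < 1) (hΦ : Function.Bijective Φ) (d : ℕ)
    (hd : d ≤ Module.finrank ConvLaurent M) :
    ∃ e : M, LinearIndependent ConvLaurent fun i : Fin d => Φ^[i] e := by
  induction d with
  | zero => exact ⟨0, linearIndependent_empty_type⟩
  | succ d ih =>
    obtain ⟨e, he⟩ := ih (by omega)
    by_contra! hdep
    have h1 := iterate_mem_span_of_forall_not_linearIndependent Φ hq he hdep
    have h2 : Submodule.span ConvLaurent (Set.range fun i : Fin d => Φ^[i] e) = ⊤ := by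
      rw [eq_top_iff]
      intro x _
      obtain ⟨f, rfl⟩ := hΦ.surjective.iterate d x
      exact h1 f
    have h3 := finrank_span_eq_card he
    rw [h2, finrank_top, Fintype.card_fin] at h3
    omega

end

/-! ### Newton polygons and factorization -/

theorem ord_one : ord 1 = 0 := order_one

theorem ord_mul {f g : ConvLaurent} (hf : f ≠ 0) (hg : g ≠ 0) : ord (f * g) = ord f + ord g :=
  order_mul (by simpa using hf) (by simpa using hg)

theorem ord_inv {f : ConvLaurent} (hf : f ≠ 0) : ord f⁻¹ = -ord f := by
  have h := ord_mul hf (inv_ne_zero hf)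
  rw [mul_inv_cancel₀ hf, ord_one] at h
  omega

theorem ordGE_coe_iff {f : ConvLaurent} (hf : f ≠ 0) {c : ℚ} :
    OrdGE (f : LaurentSeries ℂ) c ↔ c ≤ ord f :=
  ⟨fun h => h.le_order (by simpa using hf), fun h => OrdGE.of_le_order fun _ => h⟩

theorem ordGE_coe_ord (f : ConvLaurent) : OrdGE (f : LaurentSeries ℂ) (ord f) :=
  OrdGE.of_le_order fun _ => le_rfl

theorem exists_pos_forall_le {ι : Type*} (s : Finset ι) {g : ι → ℚ} (hg : ∀ i ∈ s, 0 < g i) :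
    ∃ δ : ℚ, 0 < δ ∧ ∀ i ∈ s, δ ≤ g i := by
  classical
  induction s using Finset.induction_on with
  | empty => exact ⟨1, one_pos, by simp⟩
  | insert a s ha ih =>
    obtain ⟨δ, hδ, h⟩ := ih fun i hi => hg i (by simp [hi])
    refine ⟨min (g a) δ, lt_min (hg a (by simp)) hδ, fun i hi => ?_⟩
    rcases Finset.mem_insert.1 hi with rfl | hi
    · exact min_le_left _ _
    · exact (min_le_right _ _).trans (h i hi)

/-- The leftmost edge of the Newton polygon: it has the largest slope `lam` and ends at `k`. -/
theorem exists_first_edge {m : ℕ} (hm : 0 < m) {a : ℕ → ConvLaurent} (ham : a m ≠ 0) :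
    ∃ (lam : ℚ) (k : ℕ), 0 < k ∧ k ≤ m ∧ a k ≠ 0 ∧ (ord (a 0) : ℚ) = ord (a k) + lam * k ∧
      (∀ i ≤ m, a i ≠ 0 → (ord (a 0) : ℚ) ≤ ord (a i) + lam * i) ∧
      ∀ i ≤ m, k < i → a i ≠ 0 → (ord (a 0) : ℚ) < ord (a i) + lam * i := by
  classical
  let S := (Finset.range (m + 1)).filter fun i => 0 < i ∧ a i ≠ 0
  let g : ℕ → ℚ := fun i => ((ord (a 0) : ℚ) - ord (a i)) / i
  have hg : ∀ i, 0 < i → (ord (a 0) : ℚ) = ord (a i) + g i * i := fun i hi => by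
    have : (i : ℚ) ≠ 0 := by exact_mod_cast hi.ne'
    simp only [g]
    field_simp
    ring
  -- The lexicographic order picks, among the points on the steepest line through `(0, v(a₀))`, the
  -- one farthest right; this makes the inequality beyond `k` strict.
  obtain ⟨k, hkS, hk⟩ := Finset.exists_max_image S (fun i => toLex (g i, i))
    ⟨m, by simp [S, hm, ham]⟩
  simp only [S, Finset.mem_filter, Finset.mem_range] at hkS hk
  refine ⟨g k, k, hkS.2.1, by omega, hkS.2.2, hg k hkS.2.1, fun i hi hai => ?_,
    fun i hi hki hai => ?_⟩
  · rcases Nat.eq_zero_or_pos i with rfl | hi0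
    · simp
    · have h1 := Prod.Lex.monotone_fst _ _ (hk i ⟨by omega, hi0, hai⟩)
      have h2 : g i ≤ g k := h1
      rw [hg i hi0]
      gcongr
  · have hi0 : 0 < i := by omega
    have h1 := Prod.Lex.le_iff.1 (hk i ⟨by omega, hi0, hai⟩)
    have h2 : g i < g k := by
      rcases h1 with h1 | h1
      · exact h1
      · exact absurd h1.2 (by simpa using hki)
    rw [hg i hi0]
    have : (0 : ℚ) < i := by exact_mod_cast hi0
    gcongr

/-- Both endpoints lie on a line of slope `lam` with no point below it. A supporting line of another
slope lies strictly below that line except possibly at one endpoint, so it cannot touch two points.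
-/
theorem newtonSlopes_eq_singleton {m : ℕ} (hm : 0 < m) {a : Fin (m + 1) → ConvLaurent}
    (ham : a (Fin.last m) = 1) (ha0 : a 0 ≠ 0) {lam : ℚ} (h0 : (ord (a 0) : ℚ) = lam * m)
    (h : ∀ i, OrdGE (a i : LaurentSeries ℂ) (lam * (m - (i : ℕ)))) :
    newtonSlopes a = {lam} := by
  have h' : ∀ i, a i ≠ 0 → lam * (m - (i : ℕ)) ≤ ord (a i) := fun i hi => (ordGE_coe_iff hi).1 (h i)
  have ham' : a (Fin.last m) ≠ 0 := by simp [ham]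
  ext l
  rw [Set.mem_singleton_iff]
  constructor
  · rintro ⟨b, ⟨i, j, hij, hi, hj, hbi, hbj⟩, hb⟩
    have e0 := hb 0 ha0
    have em := hb (Fin.last m) ham'
    rw [ham, ord_one] at em
    simp only [Fin.val_zero, Fin.val_last, Nat.cast_zero, Int.cast_zero] at e0 em
    wlog hlt : i < j generalizing i j
    · exact this j i hij.symm hj hi hbj hbi (lt_of_le_of_ne (not_lt.1 hlt) hij.symm)
    have hlt' : ((i : ℕ) : ℚ) < (j : ℕ) := by exact_mod_cast hlt
    have hjm : ((j : ℕ) : ℚ) ≤ m := by exact_mod_cast Nat.lt_succ_iff.1 j.2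
    have hi0 : (0 : ℚ) ≤ (i : ℕ) := by positivity
    have ei := h' i hi
    have ej := h' j hj
    rcases lt_trichotomy l lam with hl | hl | hl
    · nlinarith [mul_pos (sub_pos.2 hl) (sub_pos.2 (hlt'.trans_le hjm))]
    · exact hl
    · nlinarith [mul_pos (sub_pos.2 hl) (hi0.trans_lt hlt')]
  · rintro rfl
    refine ⟨l * m, ⟨0, Fin.last m, ?_, ha0, ham', ?_, ?_⟩, fun i hi => ?_⟩
    · simpa [Fin.ext_iff] using hm.ne
    · simpa using h0
    · simp [ham, ord_one]
    · linarith [h' i hi]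

/-- Extension by zero of a coefficient vector to a sequence. -/
noncomputable def extendZero {m : ℕ} (a : Fin (m + 1) → ConvLaurent) (n : ℕ) : ConvLaurent :=
  if h : n < m + 1 then a ⟨n, h⟩ else 0

theorem extendZero_val {m : ℕ} (a : Fin (m + 1) → ConvLaurent) (i : Fin (m + 1)) :
    extendZero a i = a i := dif_pos i.2

/-- The leftmost and the rightmost edge both have slope `lam`. The first bounds `v(a₀)` from above
by `lam * m`, the second bounds all orders from below. -/
theorem ord_of_newtonSlopes_eq_singleton {m : ℕ} {a : Fin (m + 1) → ConvLaurent}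
    (ham : a (Fin.last m) = 1) (ha0 : a 0 ≠ 0) {lam : ℚ} (h : newtonSlopes a = {lam}) :
    0 < m ∧ (ord (a 0) : ℚ) = lam * m ∧
      ∀ i, OrdGE (a i : LaurentSeries ℂ) (lam * (m - (i : ℕ))) := by
  classical
  have hm : 0 < m := by
    have h1 : lam ∈ newtonSlopes a := by rw [h]; rfl
    obtain ⟨b, ⟨i, j, hij, -⟩, -⟩ := h1
    by_contra! hm
    exact hij (Fin.ext (by omega))
  have ham' : a (Fin.last m) ≠ 0 := by simp [ham]
  let a' := extendZero a
  have ha' : ∀ i : Fin (m + 1), a' i = a i := extendZero_val a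
  have ha'0 : a' 0 = a 0 := ha' 0
  have ha'm : a' m = 1 := (ha' (Fin.last m)).trans ham
  obtain ⟨l, k, hk0, hkm, hak, hord, hle, -⟩ := exists_first_edge hm (a := a') (by simp [ha'm])
  have hl : l = lam := by
    have : l ∈ newtonSlopes a := by
      refine ⟨ord (a 0), ⟨0, ⟨k, by omega⟩, ?_, ha0, ?_, by simp, ?_⟩, fun i hi => ?_⟩
      · simpa [Fin.ext_iff] using hk0.ne
      · rw [← ha' ⟨k, by omega⟩]; exact hak
      · rw [← ha' ⟨k, by omega⟩, ← ha'0, hord]; simp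
      · rw [← ha' i] at hi ⊢
        rw [← ha'0]
        linarith [hle i (by omega) hi]
    rwa [h] at this
  subst hl
  -- The rightmost edge: it minimizes the slope of the chords to the endpoint `(m, 0)`.
  let S := Finset.univ.filter fun i : Fin (m + 1) => (i : ℕ) < m ∧ a i ≠ 0
  let g : Fin (m + 1) → ℚ := fun i => (ord (a i) : ℚ) / (m - (i : ℕ))
  obtain ⟨j, hjS, hj⟩ := Finset.exists_min_image S g ⟨0, by simp [S, hm, ha0]⟩
  simp only [S, Finset.mem_filter, Finset.mem_univ, true_and] at hjS hj
  have hpos : ∀ i : Fin (m + 1), (i : ℕ) < m → (0 : ℚ) < m - (i : ℕ) := fun i hi => by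
    rw [sub_pos]; exact_mod_cast hi
  have hg : ∀ i : Fin (m + 1), (i : ℕ) < m → (ord (a i) : ℚ) = g i * (m - (i : ℕ)) :=
    fun i hi => (div_mul_cancel₀ _ (hpos i hi).ne').symm
  have hmin : ∀ i, a i ≠ 0 → g j * (m - (i : ℕ)) ≤ ord (a i) := by
    intro i hi
    rcases Nat.lt_or_ge i m with him | him
    · rw [hg i him]
      exact mul_le_mul_of_nonneg_right (hj i ⟨him, hi⟩) (hpos i him).le
    · have : i = Fin.last m := Fin.ext (by simp; omega)
      rw [this, ham, ord_one]
      simp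
  have hgj : g j = l := by
    have : g j ∈ newtonSlopes a := by
      refine ⟨g j * m, ⟨j, Fin.last m, ?_, hjS.2, ham', ?_, ?_⟩, fun i hi => ?_⟩
      · simpa [Fin.ext_iff] using hjS.1.ne
      · rw [hg j hjS.1]; ring
      · simp [ham, ord_one]
      · linarith [hmin i hi]
    rwa [h] at this
  rw [hgj] at hmin
  refine ⟨hm, le_antisymm ?_ ?_, fun i => OrdGE.of_le_order fun hi => hmin i (by simpa using hi)⟩
  · have := hle m le_rfl (by simp [ha'm])
    rw [ha'm, ord_one, ha'0] at this
    simpa using this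
  · simpa using hmin 0 ha0

theorem ord_one_add {f : ConvLaurent} {c : ℚ} (hc : 0 < c) (hf : OrdGE (f : LaurentSeries ℂ) c) :
    1 + f ≠ 0 ∧ ord (1 + f) = 0 := by
  have h0 : ((1 + f : ConvLaurent) : LaurentSeries ℂ).coeff 0 ≠ 0 := by
    have : (f : LaurentSeries ℂ).coeff 0 = 0 := hf 0 (by simpa using hc)
    simp [this]
  have h1 : 1 + f ≠ 0 := fun h => h0 (by rw [h]; simp)
  refine ⟨h1, le_antisymm (order_le_of_coeff_ne_zero h0) ?_⟩
  have h2 : OrdGE ((1 : ConvLaurent) : LaurentSeries ℂ) 0 :=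
    (ordGE_coe_iff one_ne_zero).2 (by simp [ord_one])
  have h3 : OrdGE ((1 + f : ConvLaurent) : LaurentSeries ℂ) 0 := h2.add (hf.mono hc.le)
  exact_mod_cast (ordGE_coe_iff h1).1 h3

/-- The operator with coefficients `a` is `A * B`, where the Newton polygon of `B` is the leftmost
edge, of slope `lam`, and all slopes of `A` are smaller than `lam`. -/
theorem exists_factorization {q : ℂˣ} (hq : ‖(q : ℂ)‖ < 1) {m : ℕ} (hm : 0 < m)
    {a : ℕ → ConvLaurent} (ha0 : a 0 ≠ 0) (ham : a m = 1) (ha : ∀ n, m < n → a n = 0) :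
    ∃ (lam : ℚ) (k : ℕ) (A B : ℕ → ConvLaurent), 0 < k ∧ k ≤ m ∧
      (a k ≠ 0 ∧ (ord (a 0) : ℚ) = ord (a k) + lam * k) ∧
      (A 0 ≠ 0 ∧ A (m - k) = 1 ∧ (∀ n, m - k < n → A n = 0) ∧
        ∀ i, 0 < i → A i ≠ 0 → (ord (A 0) : ℚ) < ord (A i) + lam * i) ∧
      (B 0 ≠ 0 ∧ B k = 1 ∧ (∀ n, k < n → B n = 0) ∧ (ord (B 0) : ℚ) = lam * k ∧
        ∀ j ≤ k, OrdGE (B j : LaurentSeries ℂ) (lam * (k - j))) ∧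
      ∀ n, a n = ∑ x ∈ Finset.HasAntidiagonal.antidiagonal n, A x.1 * qShift (q ^ x.1) (B x.2) := by
  classical
  obtain ⟨lam, k, hk0, hkm, hak, hord, hle, hlt⟩ :=
    exists_first_edge hm (a := a) (by simp [ham])
  -- `δ'` is a uniform height of the points beyond `k` above the line of the first edge.
  obtain ⟨δ', hδ', hgap⟩ := exists_pos_forall_le
    ((Finset.range (m + 1)).filter fun i => k < i ∧ a i ≠ 0)
    (g := fun i => (ord (a i) : ℚ) + lam * i - ord (a 0)) fun i hi => by
      rw [Finset.mem_filter, Finset.mem_range] at hi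
      linarith [hlt i (by omega) hi.2.1 hi.2.2]
  let δ := δ' / (m + 1)
  have hm1 : (0 : ℚ) < m + 1 := by positivity
  have hδ : 0 < δ := div_pos hδ' hm1
  -- The line of the edge, bent upwards by `δ` per step from `k` on. The bend starts at `k` itself,
  -- with value `δ`, and this gives the gain in `hc`; dividing `δ'` by `m + 1` keeps the given
  -- points above the weights.
  let c : ℕ → ℚ := fun n => lam * (k - n) + δ * ((n + 1 - k : ℕ) : ℚ)
  have hc : ∀ i j, j < k → c (i + j) + δ ≤ c (i + k) + c j := by
    intro i j hj
    have h1 : i + k + 1 - k = i + 1 := by omega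
    have h2 : j + 1 - k = 0 := by omega
    have h3 : ((i + j + 1 - k : ℕ) : ℚ) ≤ i := by exact_mod_cast (by omega : i + j + 1 - k ≤ i)
    simp only [c, h1, h2]
    push_cast
    linarith [mul_le_mul_of_nonneg_left h3 hδ.le]
  let ε : ℕ → ConvLaurent := fun n => (a k)⁻¹ * a n - if n = k then 1 else 0
  have hεord : ∀ n, OrdGE (ε n : LaurentSeries ℂ) (c n) := by
    intro n
    by_cases hnk : n = k
    · subst hnk
      have : ε n = 0 := by simp [ε, hak]
      rw [this]
      exact OrdGE.zero
    by_cases han : a n = 0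
    · have : ε n = 0 := by simp [ε, hnk, han]
      rw [this]
      exact OrdGE.zero
    have hnm : n ≤ m := by
      by_contra! h
      exact han (ha n h)
    have h1 : ε n = (a k)⁻¹ * a n := by simp [ε, hnk]
    rw [h1, ordGE_coe_iff (mul_ne_zero (inv_ne_zero hak) han),
      ord_mul (inv_ne_zero hak) han, ord_inv hak]
    push_cast
    rcases lt_or_gt_of_ne hnk with hn | hn
    · have h2 : n + 1 - k = 0 := by omega
      simp only [c, h2]
      have := hle n hnm han
      push_cast
      linarith
    · have h2 := hgap n (by simp [hn, han]; omega)
      have h3 : ((n + 1 - k : ℕ) : ℚ) ≤ m + 1 := by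
        exact_mod_cast (by omega : n + 1 - k ≤ m + 1)
      have h4 : δ * ((n + 1 - k : ℕ) : ℚ) ≤ δ' :=
        (mul_le_mul_of_nonneg_left h3 hδ.le).trans (le_of_eq (div_mul_cancel₀ _ hm1.ne'))
      simp only [c]
      linarith
  obtain ⟨γ', hγ0', hγord, hγconv, hγeq⟩ := exists_factor_series (q := q) (k := k) (m := m)
    (ε := fun n => (ε n : LaurentSeries ℂ)) hq hδ hc
    (fun n hn => by simp [ε, ha n hn, show n ≠ k by omega]) hεord fun n => (ε n).2
  let γ : ℕ → ConvLaurent := fun n => ⟨γ' n, hγconv n⟩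
  have hγ0 : ∀ n, m < n → γ n = 0 := fun n hn => Subtype.ext (hγ0' n hn)
  have hγ : ∀ n, γ n + ∑ x ∈ (Finset.HasAntidiagonal.antidiagonal n).filter (fun x => x.2 < k),
      γ (x.1 + k) * qShift (q ^ x.1) (γ x.2) = ε n := by
    intro n
    refine Subtype.ext ((Eq.trans ?_ (hγeq n)))
    push_cast
    rfl
  -- One sequence `γ` encodes both factors: its terms below `k` are the lower coefficients of `B`,
  -- the others are the perturbation of `1` in `A / a k`.
  let A : ℕ → ConvLaurent := fun i => a k * ((if i = 0 then 1 else 0) + γ (i + k))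
  let B : ℕ → ConvLaurent := fun j => if j < k then γ j else if j = k then 1 else 0
  have hBlt : ∀ j < k, B j = γ j := fun j hj => by simp [B, hj]
  have hBk : B k = 1 := by simp [B]
  have hBgt : ∀ j, k < j → B j = 0 := fun j hj => by
    simp [B, show ¬ j < k by omega, show j ≠ k by omega]
  have hprod : ∀ n, a n =
      ∑ x ∈ Finset.HasAntidiagonal.antidiagonal n, A x.1 * qShift (q ^ x.1) (B x.2) := by
    intro n
    have h1 : a n = a k * ((if n = k then 1 else 0) + ε n) := by
      simp only [ε]
      rw [add_sub_cancel, mul_inv_cancel_left₀ hak]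
    have h2 : ∑ x ∈ Finset.HasAntidiagonal.antidiagonal n,
        (if x.1 = 0 then 1 else 0) * qShift (q ^ x.1) (B x.2) = B n := by
      rw [Finset.sum_eq_single (0, n)]
      · simp [qShift_one]
      · rintro ⟨i, j⟩ hx hne
        rw [Finset.HasAntidiagonal.mem_antidiagonal] at hx
        have : i ≠ 0 := fun h => hne (by ext <;> simp_all)
        simp [this]
      · intro h
        exact absurd (Finset.HasAntidiagonal.mem_antidiagonal.2 (by simp)) h
    have h3 : ∑ x ∈ (Finset.HasAntidiagonal.antidiagonal n).filter (fun x => ¬ x.2 < k),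
        γ (x.1 + k) * qShift (q ^ x.1) (B x.2) = if k ≤ n then γ n else 0 := by
      split_ifs with hkn
      · rw [Finset.sum_eq_single (n - k, k)]
        · simp [hBk, Nat.sub_add_cancel hkn]
        · rintro ⟨i, j⟩ hx hne
          rw [Finset.mem_filter, Finset.HasAntidiagonal.mem_antidiagonal] at hx
          have : k < j := by
            refine lt_of_le_of_ne (not_lt.1 hx.2) fun h => hne ?_
            subst h
            ext <;> simp; omega
          simp [hBgt j this]
        · intro h
          refine absurd ?_ h
          rw [Finset.mem_filter, Finset.HasAntidiagonal.mem_antidiagonal]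
          simp only
          omega
      · refine Finset.sum_eq_zero fun x hx => ?_
        rw [Finset.mem_filter, Finset.HasAntidiagonal.mem_antidiagonal] at hx
        omega
    have h4 : ∑ x ∈ (Finset.HasAntidiagonal.antidiagonal n).filter (fun x => x.2 < k),
        γ (x.1 + k) * qShift (q ^ x.1) (B x.2) = ε n - γ n := by
      rw [← hγ n, add_sub_cancel_left]
      refine Finset.sum_congr rfl fun x hx => ?_
      rw [hBlt _ (Finset.mem_filter.1 hx).2]
    simp only [A, mul_assoc]
    rw [← Finset.mul_sum, h1]
    congr 1
    simp only [add_mul]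
    rw [Finset.sum_add_distrib, h2, ← Finset.sum_filter_add_sum_filter_not _ (fun x => x.2 < k),
      h3, h4]
    rcases lt_trichotomy n k with hn | hn | hn
    · rw [hBlt n hn, if_neg hn.ne, if_neg (by omega)]; ring
    · subst hn
      rw [hBk, if_pos rfl, if_pos le_rfl]; ring
    · rw [hBgt n hn, if_neg hn.ne', if_pos hn.le]; ring
  -- Since `c k = δ > 0`, the factor `1 + γ k` is a unit of order `0`; thus `A 0` has the order of
  -- `a k`.
  have hγk := ord_one_add (f := γ k) (c := δ) hδ (by simpa [c] using hγord k)
  have hA0' : A 0 = a k * (1 + γ k) := by simp [A]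
  have hA0 : A 0 ≠ 0 := by rw [hA0']; exact mul_ne_zero hak hγk.1
  have hordA0 : ord (A 0) = ord (a k) := by rw [hA0', ord_mul hak hγk.1, hγk.2, add_zero]
  have ha0' : a 0 = A 0 * B 0 := by simpa [qShift_one] using hprod 0
  have hB0 : B 0 ≠ 0 := fun h => ha0 (by rw [ha0', h, mul_zero])
  have hAgt : ∀ n, m - k < n → A n = 0 := fun n hn => by
    simp only [A]
    rw [hγ0 _ (by omega), if_neg (by omega), add_zero, mul_zero]
  refine ⟨lam, k, A, B, hk0, hkm, ⟨hak, hord⟩, ⟨hA0, ?_, hAgt, fun i hi hAi => ?_⟩,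
    ⟨hB0, hBk, hBgt, ?_, fun j hj => ?_⟩, hprod⟩
  · have := hprod m
    rw [Finset.sum_eq_single (m - k, k), ham, hBk, map_one, mul_one] at this
    · exact this.symm
    · rintro ⟨i, j⟩ hx hne
      rw [Finset.HasAntidiagonal.mem_antidiagonal] at hx
      simp only at hx ⊢
      rcases lt_trichotomy j k with h | h | h
      · rw [hAgt i (by omega), zero_mul]
      · exact absurd (by ext <;> simp <;> omega) hne
      · rw [hBgt j h, map_zero, mul_zero]
    · intro h
      refine absurd ?_ h
      rw [Finset.HasAntidiagonal.mem_antidiagonal]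
      simp only
      omega
  · have h1 : A i = a k * γ (i + k) := by simp [A, hi.ne']
    rw [h1] at hAi ⊢
    have hγi := (mul_ne_zero_iff.1 hAi).2
    have h2 : c (i + k) ≤ ord (γ (i + k)) := (ordGE_coe_iff hγi).1 (hγord (i + k))
    have h3 : i + k + 1 - k = i + 1 := by omega
    simp only [c, h3] at h2
    rw [hordA0, ord_mul hak hγi]
    push_cast at h2 ⊢
    have : 0 < δ * (i + 1) := by positivity
    linarith
  · have := ord_mul hA0 hB0
    rw [← ha0', hordA0] at this
    rw [this] at hord
    push_cast at hord
    linarith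
  · rcases lt_or_eq_of_le hj with hj | rfl
    · rw [hBlt j hj]
      refine (hγord j).mono ?_
      simp [c, show j + 1 - k = 0 by omega]
    · rw [hBk, ordGE_coe_iff one_ne_zero]
      simp [ord_one]

/-! ### Lattices in pure modules -/

theorem OrdGE.qShift {f : ConvLaurent} {c : ℚ} (hf : OrdGE (f : LaurentSeries ℂ) c) (q : ℂˣ) :
    OrdGE (qShift q f : LaurentSeries ℂ) c := hf.dilate q

theorem OrdGE.qShift_symm {f : ConvLaurent} {c : ℚ} (hf : OrdGE (f : LaurentSeries ℂ) c)
    (q : ℂˣ) : OrdGE ((QDiff.qShift q).symm f : LaurentSeries ℂ) c := hf.dilate q⁻¹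

section

variable {q : ℂˣ} {M : Type*} [AddCommGroup M] [Module ConvLaurent M]
  (Φ : M →ₛₗ[(qShift q : ConvLaurent →+* ConvLaurent)] M)

theorem sum_extendZero {m : ℕ} (a : Fin (m + 1) → ConvLaurent) (e : M) :
    ∑ i ∈ Finset.range (m + 1), extendZero a i • Φ^[i] e = ∑ i : Fin (m + 1), a i • Φ^[i] e := by
  rw [← Fin.sum_univ_eq_sum_range (fun i => extendZero a i • Φ^[i] e)]
  exact Finset.sum_congr rfl fun i _ => by rw [extendZero_val]

/-- The vectors `∑ yᵢ Φ ^ i e` with `v(yᵢ) + lam * i ≥ c`. -/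
def slopeLattice (e : M) (m : ℕ) (lam c : ℚ) : AddSubgroup M where
  carrier := {x | ∃ y : ℕ → ConvLaurent,
    (∀ i < m, OrdGE (y i : LaurentSeries ℂ) (c - lam * i)) ∧
      x = ∑ i ∈ Finset.range m, y i • Φ^[i] e}
  zero_mem' := ⟨0, fun _ _ => OrdGE.zero, by simp⟩
  add_mem' := by
    rintro _ _ ⟨y, hy, rfl⟩ ⟨z, hz, rfl⟩
    exact ⟨y + z, fun i hi => (hy i hi).add (hz i hi), by
      simp [add_smul, Finset.sum_add_distrib]⟩
  neg_mem' := by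
    rintro _ ⟨y, hy, rfl⟩
    exact ⟨-y, fun i hi => (hy i hi).neg, by simp⟩

variable {Φ} {e x : M} {m : ℕ} {lam c : ℚ}

theorem slopeLattice_mono {d : ℚ} (h : d ≤ c) (hx : x ∈ slopeLattice Φ e m lam c) :
    x ∈ slopeLattice Φ e m lam d := by
  obtain ⟨y, hy, rfl⟩ := hx
  exact ⟨y, fun i hi => (hy i hi).mono (by linarith), rfl⟩

theorem smul_mem_slopeLattice {b : ConvLaurent} {d : ℚ} (hb : OrdGE (b : LaurentSeries ℂ) d)
    (hx : x ∈ slopeLattice Φ e m lam c) : b • x ∈ slopeLattice Φ e m lam (c + d) := by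
  obtain ⟨y, hy, rfl⟩ := hx
  refine ⟨fun i => b * y i, fun i hi => (hb.mul (hy i hi)).mono (by linarith), ?_⟩
  simp [Finset.smul_sum, smul_smul]

theorem exists_mem_slopeLattice (lam : ℚ)
    (hspan : Submodule.span ConvLaurent (Set.range fun i : Fin m => Φ^[i] e) = ⊤) (x : M) :
    ∃ c, x ∈ slopeLattice Φ e m lam c := by
  have hx : x ∈ Submodule.span ConvLaurent (Set.range fun i : Fin m => Φ^[i] e) := by
    rw [hspan]; trivial
  obtain ⟨y, rfl⟩ := (Submodule.mem_span_range_iff_exists_fun _).1 hx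
  let z : ℕ → ConvLaurent := fun i => if h : i < m then y ⟨i, h⟩ else 0
  refine ⟨-∑ i ∈ Finset.range m, |(ord (z i) : ℚ) + lam * i|, z, fun i hi => ?_, ?_⟩
  · refine (ordGE_coe_ord (z i)).mono ?_
    have h1 := Finset.single_le_sum (f := fun i => |(ord (z i) : ℚ) + lam * i|)
      (fun _ _ => abs_nonneg _) (Finset.mem_range.2 hi)
    linarith [neg_abs_le ((ord (z i) : ℚ) + lam * i)]
  · rw [← Fin.sum_univ_eq_sum_range (fun i => z i • Φ^[i] e)]
    exact Finset.sum_congr rfl fun i _ => by simp [z]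

theorem eq_zero_of_forall_mem_slopeLattice
    (hli : LinearIndependent ConvLaurent fun i : Fin m => Φ^[i] e)
    (h : ∀ c, x ∈ slopeLattice Φ e m lam c) : x = 0 := by
  obtain ⟨y, -, rfl⟩ := h 0
  refine Finset.sum_eq_zero fun i hi => ?_
  rw [Finset.mem_range] at hi
  suffices h0 : y i = 0 by rw [h0, zero_smul]
  refine Subtype.ext (OrdGE.eq_zero fun d => ?_)
  obtain ⟨z, hz, hyz⟩ := h (d + lam * i)
  rw [← Fin.sum_univ_eq_sum_range (fun i => y i • Φ^[i] e),
    ← Fin.sum_univ_eq_sum_range (fun i => z i • Φ^[i] e)] at hyz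
  have h1 := congrFun (hli.fintypeLinearCombination_injective
    (a₁ := fun i : Fin m => y i) (a₂ := fun i : Fin m => z i)
    (by simpa [Fintype.linearCombination_apply] using hyz)) ⟨i, hi⟩
  simp only at h1
  rw [h1]
  exact (hz i hi).mono (by linarith)

section Relation

variable {a : ℕ → ConvLaurent} (ham : a m = 1)
  (ha : ∀ i ≤ m, OrdGE (a i : LaurentSeries ℂ) (lam * (m - i)))
  (hrel : ∑ i ∈ Finset.range (m + 1), a i • Φ^[i] e = 0)

include ham ha hrel in
-- Only `i = m` needs an argument: the relation rewrites `Φ ^ m e`, and the polygon bound on `a` is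
-- exactly what preserves the level `c`.
theorem smul_iterate_mem_slopeLattice {i : ℕ} (hi : i ≤ m) {y : ConvLaurent}
    (hy : OrdGE (y : LaurentSeries ℂ) (c - lam * i)) :
    y • Φ^[i] e ∈ slopeLattice Φ e m lam c := by
  rcases lt_or_eq_of_le hi with hi | rfl
  · refine ⟨fun j => if j = i then y else 0, fun j _ => ?_, ?_⟩
    · by_cases h : j = i
      · simpa [h] using hy
      · simpa [h] using OrdGE.zero
    · simp only [ite_smul, zero_smul, Finset.sum_ite_eq', Finset.mem_range, hi, if_true]
  · refine ⟨fun j => -(y * a j), fun j hj => ?_, ?_⟩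
    · exact ((hy.mul (ha j hj.le)).neg).mono (by linarith)
    · rw [Finset.sum_range_succ, ham, one_smul] at hrel
      rw [eq_neg_of_add_eq_zero_right hrel, smul_neg, Finset.smul_sum]
      simp [smul_smul]

include ham ha hrel in
theorem map_mem_slopeLattice (hx : x ∈ slopeLattice Φ e m lam c) :
    Φ x ∈ slopeLattice Φ e m lam (c + lam) := by
  obtain ⟨y, hy, rfl⟩ := hx
  rw [map_sum]
  refine sum_mem fun i hi => ?_
  rw [Finset.mem_range] at hi
  rw [map_smul_qShift, ← Function.iterate_succ_apply' Φ]
  refine smul_iterate_mem_slopeLattice ham ha hrel hi (((hy i hi).qShift q).mono ?_)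
  push_cast
  linarith

include ham ha hrel in
theorem iterate_mem_slopeLattice (hx : x ∈ slopeLattice Φ e m lam c) (n : ℕ) :
    Φ^[n] x ∈ slopeLattice Φ e m lam (c + lam * n) := by
  induction n with
  | zero => simpa using hx
  | succ n ih =>
    rw [Function.iterate_succ_apply']
    exact slopeLattice_mono (le_of_eq (by push_cast; ring)) (map_mem_slopeLattice ham ha hrel ih)

include ha hrel in
-- The relation is solved for `e` in terms of `Φ e, …, Φ ^ m e`, and `φ⁻¹` is applied to the
-- coefficients. The exact order `lam * m` of `a 0` is what prevents a loss when dividing by it.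
theorem mem_slopeLattice_of_map_mem (hΦ : Function.Injective Φ) (hm : 0 < m) (ha0 : a 0 ≠ 0)
    (hord : (ord (a 0) : ℚ) = lam * m) (hx : Φ x ∈ slopeLattice Φ e m lam (c + lam)) :
    x ∈ slopeLattice Φ e m lam c := by
  obtain ⟨y, hy, hxy⟩ := hx
  obtain ⟨m, rfl⟩ := Nat.exists_eq_succ_of_ne_zero hm.ne'
  -- The coefficients of `Φ x` on `Φ e, …, Φ ^ (m + 1) e` once `e` is eliminated; the top one comes
  -- from the relation alone.
  let u : ℕ → ConvLaurent := fun i =>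
    (if i < m then y (i + 1) else 0) - y 0 * (a 0)⁻¹ * a (i + 1)
  have hu : ∀ i < m + 1, OrdGE (u i : LaurentSeries ℂ) (c - lam * i) := by
    intro i hi
    refine OrdGE.sub (f := ((if i < m then y (i + 1) else 0 : ConvLaurent) : LaurentSeries ℂ))
      ?_ ?_
    · split_ifs with him
      · refine (hy (i + 1) (by omega)).mono ?_
        push_cast
        linarith
      · exact OrdGE.zero
    · have h1 : OrdGE (((a 0)⁻¹ : ConvLaurent) : LaurentSeries ℂ) (-(lam * (m + 1 : ℕ))) := by
        rw [ordGE_coe_iff (inv_ne_zero ha0), ord_inv ha0, Int.cast_neg, hord]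
      refine (((hy 0 hm).mul h1).mul (ha (i + 1) (by omega))).mono ?_
      push_cast
      linarith
  have hΦx : Φ x = Φ (∑ i ∈ Finset.range (m + 1), (qShift q).symm (u i) • Φ^[i] e) := by
    have he : e = -∑ i ∈ Finset.range (m + 1), ((a 0)⁻¹ * a (i + 1)) • Φ^[i + 1] e := by
      rw [Finset.sum_range_succ', Function.iterate_zero_apply] at hrel
      have h1 := eq_neg_of_add_eq_zero_right hrel
      have h2 := congrArg ((a 0)⁻¹ • ·) h1
      simp only [smul_smul, inv_mul_cancel₀ ha0, one_smul, smul_neg, Finset.smul_sum] at h2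
      exact h2
    rw [hxy, map_sum]
    simp only [map_smul_qShift, RingEquiv.apply_symm_apply, ← Function.iterate_succ_apply' Φ,
      u, sub_smul, Finset.sum_sub_distrib]
    rw [Finset.sum_range_succ' (fun i => y i • Φ^[i] e), Function.iterate_zero_apply,
      Finset.sum_range_succ (fun i => (if i < m then y (i + 1) else 0) • Φ^[i + 1] e),
      if_neg (lt_irrefl m), zero_smul, add_zero, sub_eq_add_neg]
    congr 1
    · exact Finset.sum_congr rfl fun i hi => by rw [if_pos (Finset.mem_range.1 hi)]
    · conv_lhs => rw [he]
      rw [smul_neg, Finset.smul_sum]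
      simp only [smul_smul, mul_assoc]
  refine ⟨fun i => (qShift q).symm (u i), fun i hi => (hu i hi).qShift_symm q, hΦ hΦx⟩

include ha hrel in
theorem mem_slopeLattice_of_iterate_mem (hΦ : Function.Injective Φ) (hm : 0 < m) (ha0 : a 0 ≠ 0)
    (hord : (ord (a 0) : ℚ) = lam * m) (n : ℕ)
    (hx : Φ^[n] x ∈ slopeLattice Φ e m lam (c + lam * n)) :
    x ∈ slopeLattice Φ e m lam c := by
  induction n with
  | zero => simpa using hx
  | succ n ih =>
    refine ih (mem_slopeLattice_of_map_mem ha hrel hΦ hm ha0 hord ?_)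
    rw [← Function.iterate_succ_apply' Φ]
    exact slopeLattice_mono (le_of_eq (by push_cast; ring)) hx

end Relation

/-- An operator that is pure of slope `lam'` acts injectively on modules that are pure of another
slope. -/
theorem IsPure.eq_zero_of_sum_eq_zero (hΦ : Function.Injective Φ) (hpure : IsPure Φ lam)
    {n : ℕ} {b : Fin (n + 1) → ConvLaurent} (hbn : b (Fin.last n) = 1) (hb0 : b 0 ≠ 0)
    {lam' : ℚ} (hb : newtonSlopes b = {lam'}) (hne : lam' ≠ lam)
    (hx : ∑ i : Fin (n + 1), b i • Φ^[i] x = 0) : x = 0 := by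
  obtain ⟨m, a, ⟨ham, ha0, e, hli, hspan, hrel⟩, ha⟩ := hpure
  obtain ⟨hm, hord, haord⟩ := ord_of_newtonSlopes_eq_singleton ham ha0 ha
  obtain ⟨-, hbord0, hbord⟩ := ord_of_newtonSlopes_eq_singleton hbn hb0 hb
  rw [← sum_extendZero] at hrel hx
  have ham' : extendZero a m = 1 := (extendZero_val a (Fin.last m)).trans ham
  have ha0' : extendZero a 0 ≠ 0 := by rwa [show extendZero a 0 = a 0 from extendZero_val a 0]
  have hord' : (ord (extendZero a 0) : ℚ) = lam * m := by
    rwa [show extendZero a 0 = a 0 from extendZero_val a 0]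
  have haord' : ∀ i ≤ m, OrdGE (extendZero a i : LaurentSeries ℂ) (lam * (m - i)) := by
    intro i hi
    have := haord ⟨i, by omega⟩
    rwa [← extendZero_val a] at this
  have hbn' : extendZero b n = 1 := (extendZero_val b (Fin.last n)).trans hbn
  have hb0' : extendZero b 0 = b 0 := extendZero_val b 0
  have hbord' : ∀ i ≤ n, OrdGE (extendZero b i : LaurentSeries ℂ) (lam' * (n - i)) := by
    intro i hi
    have := hbord ⟨i, by omega⟩
    rwa [← extendZero_val b] at this
  have hterm : ∀ {c : ℚ} {i : ℕ}, x ∈ slopeLattice Φ e m lam c → i ≤ n →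
      extendZero b i • Φ^[i] x ∈
        slopeLattice Φ e m lam (c + lam * i + lam' * (n - i)) := fun hc hi =>
    smul_mem_slopeLattice (hbord' _ hi) (iterate_mem_slopeLattice ham' haord' hrel hc _)
  -- The term `bᵢ Φ ^ i x` has level `c + lam * i + lam' * (n - i)`. The lowest one is `i = 0` if
  -- `lam' < lam` and `i = n` if `lam' > lam`. Isolating it shows that `x` lies `|lam - lam'|`
  -- deeper, and this can be repeated indefinitely.
  obtain ⟨δ, hδ, hstep⟩ : ∃ δ : ℚ, 0 < δ ∧ ∀ c, x ∈ slopeLattice Φ e m lam c →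
      x ∈ slopeLattice Φ e m lam (c + δ) := by
    rcases lt_or_gt_of_ne hne with hlt | hlt
    · refine ⟨lam - lam', sub_pos.2 hlt, fun c hc => ?_⟩
      rw [Finset.sum_range_succ', Function.iterate_zero_apply, hb0'] at hx
      have h1 : b 0 • x ∈ slopeLattice Φ e m lam (c + lam' * n + (lam - lam')) := by
        rw [eq_neg_of_add_eq_zero_right hx]
        refine neg_mem (sum_mem fun i hi => ?_)
        rw [Finset.mem_range] at hi
        refine slopeLattice_mono ?_ (hterm hc (i := i + 1) (by omega))
        have : (0 : ℚ) ≤ (lam - lam') * i := mul_nonneg (sub_pos.2 hlt).le (by positivity)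
        push_cast
        linarith
      have h2 : OrdGE (((b 0)⁻¹ : ConvLaurent) : LaurentSeries ℂ) (-(lam' * n)) := by
        rw [ordGE_coe_iff (inv_ne_zero hb0), ord_inv hb0, Int.cast_neg, hbord0]
      have h3 := smul_mem_slopeLattice h2 h1
      rw [smul_smul, inv_mul_cancel₀ hb0, one_smul] at h3
      exact slopeLattice_mono (by linarith) h3
    · refine ⟨lam' - lam, sub_pos.2 hlt, fun c hc => ?_⟩
      rw [Finset.sum_range_succ, hbn', one_smul] at hx
      refine mem_slopeLattice_of_iterate_mem haord' hrel hΦ hm ha0' hord' n ?_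
      rw [eq_neg_of_add_eq_zero_right hx]
      refine neg_mem (sum_mem fun i hi => ?_)
      rw [Finset.mem_range] at hi
      refine slopeLattice_mono ?_ (hterm hc hi.le)
      have h1 : (1 : ℚ) ≤ n - i := by
        have : ((i + 1 : ℕ) : ℚ) ≤ n := by exact_mod_cast hi
        push_cast at this
        linarith
      nlinarith [mul_le_mul_of_nonneg_left h1 (sub_pos.2 hlt).le]
  obtain ⟨c₀, hc₀⟩ := exists_mem_slopeLattice lam hspan x
  have hall : ∀ k : ℕ, x ∈ slopeLattice Φ e m lam (c₀ + k * δ) := by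
    intro k
    induction k with
    | zero => simpa using hc₀
    | succ k ih =>
      exact slopeLattice_mono (le_of_eq (by push_cast; ring)) (hstep _ ih)
  refine eq_zero_of_forall_mem_slopeLattice (lam := lam) hli fun c => ?_
  obtain ⟨k, hk⟩ := exists_nat_gt ((c - c₀) / δ)
  rw [div_lt_iff₀ hδ] at hk
  exact slopeLattice_mono (by linarith) (hall k)

end

/-! ### Subquotients and the construction of the tower -/

theorem sum_range_sum_antidiagonal {V : Type*} [AddCommMonoid V] {p k : ℕ} {F : ℕ → ℕ → V}
    (h₁ : ∀ i j, p < i → F i j = 0) (h₂ : ∀ i j, k < j → F i j = 0) :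
    ∑ n ∈ Finset.range (p + k + 1), ∑ x ∈ Finset.HasAntidiagonal.antidiagonal n, F x.1 x.2 =
      ∑ i ∈ Finset.range (p + 1), ∑ j ∈ Finset.range (k + 1), F i j := by
  rw [← Finset.sum_product' (f := F), ← Finset.sum_fiberwise_of_maps_to
    (s := Finset.range (p + 1) ×ˢ Finset.range (k + 1)) (g := fun x => x.1 + x.2)
    (t := Finset.range (p + k + 1)) (fun x hx => ?_)]
  · refine Finset.sum_congr rfl fun n _ => (Finset.sum_subset (fun x hx => ?_)
      fun x hx hx' => ?_).symm
    · rw [Finset.mem_filter] at hx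
      exact Finset.HasAntidiagonal.mem_antidiagonal.2 hx.2
    · rw [Finset.HasAntidiagonal.mem_antidiagonal] at hx
      rw [Finset.mem_filter, Finset.mem_product, Finset.mem_range, Finset.mem_range] at hx'
      by_cases h : p < x.1
      · exact h₁ _ _ h
      · exact h₂ _ _ (by by_contra! h'; exact hx' ⟨⟨by omega, by omega⟩, hx⟩)
  · rw [Finset.mem_product, Finset.mem_range, Finset.mem_range] at hx
    rw [Finset.mem_range]
    omega

theorem strictMono_snoc {α : Type*} [Preorder α] {r : ℕ} {f : Fin r → α} {x : α}
    (hf : StrictMono f) (hx : ∀ i, f i < x) :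
    StrictMono (Fin.snoc f x : Fin (r + 1) → α) := by
  intro i j hij
  induction j using Fin.lastCases with
  | last =>
    induction i using Fin.lastCases with
    | last => exact absurd hij (lt_irrefl _)
    | cast i => simpa using hx i
  | cast j =>
    induction i using Fin.lastCases with
    | last => exact absurd hij (not_lt.2 (Fin.le_last _))
    | cast i => simpa using hf (Fin.castSucc_lt_castSucc_iff.1 hij)

section

variable {q : ℂˣ} {M : Type*} [AddCommGroup M] [Module ConvLaurent M]
  {Φ : M →ₛₗ[(qShift q : ConvLaurent →+* ConvLaurent)] M}

theorem IsStable.iterate_mem {N : Submodule ConvLaurent M} (hN : IsStable Φ N) {x : M}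
    (hx : x ∈ N) (i : ℕ) : Φ^[i] x ∈ N := by
  induction i with
  | zero => exact hx
  | succ i ih =>
    rw [Function.iterate_succ_apply']
    exact (hN _).2 ih

section Subquotient

variable {N₁ N₂ : Submodule ConvLaurent M} (h₁ : IsStable Φ N₁) (h₂ : IsStable Φ N₂)

theorem subquotient_iterate_mk {e : M} (he : e ∈ N₂) (i : ℕ) :
    (subquotient Φ N₁ N₂ h₁ h₂)^[i] (Submodule.Quotient.mk ⟨e, he⟩) =
      Submodule.Quotient.mk ⟨Φ^[i] e, h₂.iterate_mem he i⟩ := by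
  induction i with
  | zero => rfl
  | succ i ih =>
    rw [Function.iterate_succ_apply', ih]
    refine congrArg Submodule.Quotient.mk (Subtype.ext ?_)
    exact (Function.iterate_succ_apply' Φ i e).symm

theorem sum_smul_subquotient_iterate {ι : Type*} [Fintype ι] (c : ι → ConvLaurent) (n : ι → ℕ)
    {e : M} (he : e ∈ N₂) :
    ∑ i, c i • (subquotient Φ N₁ N₂ h₁ h₂)^[n i] (Submodule.Quotient.mk ⟨e, he⟩) =
      Submodule.Quotient.mk ⟨∑ i, c i • Φ^[n i] e,
        sum_mem fun _ _ => N₂.smul_mem _ (h₂.iterate_mem he _)⟩ := by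
  simp only [subquotient_iterate_mk, ← Submodule.Quotient.mk_smul]
  rw [← Submodule.mkQ_apply]
  simp only [← Submodule.mkQ_apply, ← map_sum]
  congr 1
  exact Subtype.ext (by simp)

theorem mk_submoduleOf_eq_zero_iff {x : N₂} :
    (Submodule.Quotient.mk x : N₂ ⧸ N₁.submoduleOf N₂) = 0 ↔ (x : M) ∈ N₁ :=
  Submodule.Quotient.mk_eq_zero _

theorem subquotient_injective : Function.Injective (subquotient Φ N₁ N₂ h₁ h₂) := by
  rw [injective_iff_map_eq_zero]
  intro x hx
  obtain ⟨x, rfl⟩ := Submodule.Quotient.mk_surjective _ x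
  exact mk_submoduleOf_eq_zero_iff.2 ((h₁ _).1 (mk_submoduleOf_eq_zero_iff.1 hx))

theorem isPure_subquotient {m : ℕ} {a : Fin (m + 1) → ConvLaurent} {lam : ℚ} {e : M}
    (he : e ∈ N₂) (ham : a (Fin.last m) = 1) (ha0 : a 0 ≠ 0)
    (hli : ∀ c : Fin m → ConvLaurent, ∑ i, c i • Φ^[i] e ∈ N₁ → c = 0)
    (hspan : N₂ ≤ N₁ ⊔ Submodule.span ConvLaurent (Set.range fun i : Fin m => Φ^[i] e))
    (hrel : ∑ i, a i • Φ^[i] e ∈ N₁) (ha : newtonSlopes a = {lam}) :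
    IsPure (subquotient Φ N₁ N₂ h₁ h₂) lam := by
  refine ⟨m, a, ⟨ham, ha0, Submodule.Quotient.mk ⟨e, he⟩, ?_, ?_, ?_⟩, ha⟩
  · rw [Fintype.linearIndependent_iff]
    intro c hc
    rw [sum_smul_subquotient_iterate h₁ h₂ c (fun i => (i : ℕ)) he,
      mk_submoduleOf_eq_zero_iff] at hc
    exact congrFun (hli c hc)
  · rw [eq_top_iff]
    rintro x -
    obtain ⟨⟨x, hx⟩, rfl⟩ := Submodule.Quotient.mk_surjective _ x
    obtain ⟨y, hy, z, hz, hyz⟩ := Submodule.mem_sup.1 (hspan hx)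
    obtain ⟨c, rfl⟩ := (Submodule.mem_span_range_iff_exists_fun _).1 hz
    rw [Submodule.mem_span_range_iff_exists_fun]
    refine ⟨c, ?_⟩
    rw [sum_smul_subquotient_iterate h₁ h₂ c (fun i => (i : ℕ)) he, Submodule.Quotient.eq,
      ← neg_mem_iff]
    change -(∑ i, c i • Φ^[i] e - x) ∈ N₁
    rw [← hyz]
    simpa using hy
  · rw [sum_smul_subquotient_iterate h₁ h₂ a (fun i => (i : ℕ)) he, mk_submoduleOf_eq_zero_iff]
    exact hrel

theorem IsPure.exists_generator {lam : ℚ} (h : IsPure (subquotient Φ N₁ N₂ h₁ h₂) lam) :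
    ∃ (m : ℕ) (a : Fin (m + 1) → ConvLaurent) (e : M), e ∈ N₂ ∧ a (Fin.last m) = 1 ∧ a 0 ≠ 0 ∧
      N₂ ≤ N₁ ⊔ Submodule.span ConvLaurent (Set.range fun i : Fin m => Φ^[i] e) ∧
      ∑ i, a i • Φ^[i] e ∈ N₁ ∧ newtonSlopes a = {lam} := by
  obtain ⟨m, a, ⟨ham, ha0, e, -, hspan, hrel⟩, ha⟩ := h
  obtain ⟨⟨e, he⟩, rfl⟩ := Submodule.Quotient.mk_surjective _ e
  refine ⟨m, a, e, he, ham, ha0, fun x hx => ?_, ?_, ha⟩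
  · have hx' : (Submodule.Quotient.mk ⟨x, hx⟩ : N₂ ⧸ N₁.submoduleOf N₂) ∈
        Submodule.span ConvLaurent (Set.range fun i : Fin m =>
          (subquotient Φ N₁ N₂ h₁ h₂)^[i] (Submodule.Quotient.mk ⟨e, he⟩)) := by
      rw [hspan]; trivial
    obtain ⟨c, hc⟩ := (Submodule.mem_span_range_iff_exists_fun _).1 hx'
    rw [sum_smul_subquotient_iterate h₁ h₂ c (fun i => (i : ℕ)) he, eq_comm,
      Submodule.Quotient.eq] at hc
    have hc' : x - ∑ i, c i • Φ^[i] e ∈ N₁ := hc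
    rw [← sub_add_cancel x (∑ i, c i • Φ^[i] e)]
    exact Submodule.add_mem_sup hc'
      ((Submodule.mem_span_range_iff_exists_fun _).2 ⟨c, rfl⟩)
  · rwa [sum_smul_subquotient_iterate h₁ h₂ a (fun i => (i : ℕ)) he,
      mk_submoduleOf_eq_zero_iff] at hrel

theorem IsPure.congr_subquotient {N₁' N₂' : Submodule ConvLaurent M} {lam : ℚ}
    (h : IsPure (subquotient Φ N₁ N₂ h₁ h₂) lam) (e₁ : N₁' = N₁) (e₂ : N₂' = N₂)
    (h₁' : IsStable Φ N₁') (h₂' : IsStable Φ N₂') :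
    IsPure (subquotient Φ N₁' N₂' h₁' h₂') lam := by
  subst e₁ e₂
  exact h

end Subquotient

/-- `N` has a tower of difference submodules with pure quotients of increasing slopes, all of them
smaller than `b`. -/
def HasFiltrationBelow (Φ : M →ₛₗ[(qShift q : ConvLaurent →+* ConvLaurent)] M)
    (N : Submodule ConvLaurent M) (b : ℚ) : Prop :=
  ∃ (r : ℕ) (F : Fin (r + 1) → Submodule ConvLaurent M) (lam : Fin r → ℚ)
    (st : ∀ i, IsStable Φ (F i)), F 0 = ⊥ ∧ F (Fin.last r) = N ∧ StrictMono F ∧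
    (∀ i : Fin r, IsPure
      (subquotient Φ (F i.castSucc) (F i.succ) (st i.castSucc) (st i.succ)) (lam i)) ∧
    StrictMono lam ∧ ∀ i, lam i < b

theorem isStable_bot (hΦ : Function.Injective Φ) : IsStable Φ ⊥ := fun x => by
  rw [Submodule.mem_bot, Submodule.mem_bot, map_eq_zero_iff Φ hΦ]

theorem hasFiltrationBelow_bot (hΦ : Function.Injective Φ) (b : ℚ) :
    HasFiltrationBelow Φ ⊥ b :=
  ⟨0, fun _ => ⊥, Fin.elim0, fun _ => isStable_bot hΦ, rfl, rfl,
    Fin.strictMono_iff_lt_succ.2 fun i => i.elim0, fun i => i.elim0, fun i => i.elim0,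
    fun i => i.elim0⟩

/-- The bound on the slopes of `N'` is the new slope itself, which keeps the slopes increasing; the
bound `b` allows the next extension. -/
theorem HasFiltrationBelow.snoc {N N' : Submodule ConvLaurent M} {lam b : ℚ}
    (h : HasFiltrationBelow Φ N' lam) (hN' : IsStable Φ N') (hN : IsStable Φ N) (hlt : N' < N)
    (hpure : IsPure (subquotient Φ N' N hN' hN) lam) (hb : lam < b) :
    HasFiltrationBelow Φ N b := by
  obtain ⟨r, F, l, st, hF0, hFr, hF, hFpure, hl, hlb⟩ := h
  have st' : ∀ i, IsStable Φ ((Fin.snoc F N : Fin (r + 1 + 1) → Submodule ConvLaurent M) i) := by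
    intro i
    induction i using Fin.lastCases with
    | last => simpa using hN
    | cast i => simpa using st i
  refine ⟨r + 1, Fin.snoc F N, Fin.snoc l lam, st', ?_, by simp, ?_, fun i => ?_, ?_, fun i => ?_⟩
  · rw [← hF0]
    exact Fin.snoc_castSucc (α := fun _ => Submodule ConvLaurent M) N F 0
  · exact strictMono_snoc hF fun i => ((hF.monotone (Fin.le_last i)).trans hFr.le).trans_lt hlt
  · induction i using Fin.lastCases with
    | last =>
      rw [Fin.snoc_last (α := fun _ => ℚ)]
      exact hpure.congr_subquotient hN' hN ((Fin.snoc_castSucc _ _ _).trans hFr)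
        (Fin.snoc_last _ _) _ _
    | cast i =>
      rw [Fin.snoc_castSucc (α := fun _ => ℚ)]
      refine (hFpure i).congr_subquotient _ _ (Fin.snoc_castSucc _ _ _) ?_ _ _
      rw [Fin.succ_castSucc]
      exact Fin.snoc_castSucc (α := fun _ => Submodule ConvLaurent M) N F i.succ
  · exact strictMono_snoc hl hlb
  · induction i using Fin.lastCases with
    | last => simpa using hb
    | cast i => simpa using (hlb i).trans hb

/-- The span of `e, …, Φ ^ (m - 1) e`. -/
noncomputable def iterateSpan (Φ : M →ₛₗ[(qShift q : ConvLaurent →+* ConvLaurent)] M) (m : ℕ) (e : M) :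
    Submodule ConvLaurent M :=
  Submodule.span ConvLaurent (Set.range fun i : Fin m => Φ^[i] e)

theorem iterate_mem_iterateSpan {m i : ℕ} (hi : i < m) (e : M) : Φ^[i] e ∈ iterateSpan Φ m e :=
  Submodule.subset_span ⟨⟨i, hi⟩, rfl⟩

/-- Monicity gives stability under `Φ`. Because `a 0 ≠ 0`, the relation also writes `e` through its
higher iterates, so the span lies in its own image under `Φ`. -/
theorem isStable_iterateSpan (hΦ : Function.Injective Φ) {m : ℕ} {a : ℕ → ConvLaurent}
    (ham : a m = 1) (ha0 : a 0 ≠ 0) {e : M}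
    (hrel : ∑ i ∈ Finset.range (m + 1), a i • Φ^[i] e = 0) :
    IsStable Φ (iterateSpan Φ m e) := by
  have hm : Φ^[m] e ∈ iterateSpan Φ m e := by
    rw [Finset.sum_range_succ, ham, one_smul] at hrel
    rw [eq_neg_of_add_eq_zero_right hrel]
    exact neg_mem (sum_mem fun i hi =>
      Submodule.smul_mem _ _ (iterate_mem_iterateSpan (Finset.mem_range.1 hi) e))
  have hle : ∀ x ∈ iterateSpan Φ m e, Φ x ∈ iterateSpan Φ m e := by
    intro x hx
    refine (Submodule.span_le (p := (iterateSpan Φ m e).comap Φ)).2 ?_ hx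
    rintro _ ⟨i, rfl⟩
    change Φ (Φ^[i] e) ∈ iterateSpan Φ m e
    rw [← Function.iterate_succ_apply' Φ]
    rcases lt_or_eq_of_le (Nat.succ_le_of_lt i.2) with h | h
    · exact iterate_mem_iterateSpan h e
    · rw [h]; exact hm
  have hsub : iterateSpan Φ m e ≤ (iterateSpan Φ m e).map Φ := by
    refine Submodule.span_le.2 ?_
    rintro _ ⟨⟨i, hi⟩, rfl⟩
    have hstep : ∀ j < m, Φ^[j + 1] e ∈ (iterateSpan Φ m e).map Φ := fun j hj => by
      rw [Function.iterate_succ_apply']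
      exact Submodule.mem_map_of_mem (iterate_mem_iterateSpan hj e)
    rcases i with _ | i
    · rw [Finset.sum_range_succ', Function.iterate_zero_apply] at hrel
      have h1 : a 0 • e ∈ (iterateSpan Φ m e).map Φ := by
        rw [eq_neg_of_add_eq_zero_right hrel]
        exact neg_mem (sum_mem fun j hj =>
          Submodule.smul_mem _ _ (hstep j (Finset.mem_range.1 hj)))
      exact (Submodule.smul_mem_iff _ ha0).1 h1
    · exact hstep i (by omega)
  refine fun x => ⟨fun hx => ?_, hle x⟩
  obtain ⟨y, hy, hyx⟩ := hsub hx
  rwa [← hΦ hyx]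

/-- Multiplication in the twisted polynomial ring, evaluated at `e`: `A (B e) = (A * B) e`. -/
theorem sum_smul_iterate_sum (A B : ℕ → ConvLaurent) {p k : ℕ} (hA : ∀ n, p < n → A n = 0)
    (hB : ∀ n, k < n → B n = 0) (e : M) :
    ∑ i ∈ Finset.range (p + 1), A i • Φ^[i] (∑ j ∈ Finset.range (k + 1), B j • Φ^[j] e) =
      ∑ n ∈ Finset.range (p + k + 1), (∑ x ∈ Finset.HasAntidiagonal.antidiagonal n,
        A x.1 * qShift (q ^ x.1) (B x.2)) • Φ^[n] e := by
  have h1 := sum_range_sum_antidiagonal (p := p) (k := k)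
    (F := fun i j => (A i * qShift (q ^ i) (B j)) • Φ^[i + j] e)
    (fun i j hi => by simp [hA i hi]) (fun i j hj => by simp [hB j hj])
  calc _ = ∑ i ∈ Finset.range (p + 1), ∑ j ∈ Finset.range (k + 1),
        (A i * qShift (q ^ i) (B j)) • Φ^[i + j] e := by
        refine Finset.sum_congr rfl fun i _ => ?_
        rw [iterate_sum, Finset.smul_sum]
        refine Finset.sum_congr rfl fun j _ => ?_
        rw [iterate_smul, smul_smul, ← Function.iterate_add_apply]
    _ = _ := by
        rw [← h1]
        refine Finset.sum_congr rfl fun n _ => ?_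
        rw [Finset.sum_smul]
        refine Finset.sum_congr rfl fun x hx => ?_
        rw [Finset.HasAntidiagonal.mem_antidiagonal.1 hx]

/-- `B` is monic of degree `k`, so `Φ ^ (i - k) f` is `Φ ^ i e` plus lower iterates of `e`. This
triangular change of family spans, and counting dimensions makes it independent. -/
theorem linearIndependent_sumElim_iterate {m k : ℕ} (hkm : k ≤ m) {B : ℕ → ConvLaurent}
    (hBk : B k = 1) {e f : M} (he : LinearIndependent ConvLaurent fun i : Fin m => Φ^[i] e)
    (hf : f = ∑ j ∈ Finset.range (k + 1), B j • Φ^[j] e) :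
    LinearIndependent ConvLaurent
      (Sum.elim (fun i : Fin k => Φ^[i] e) fun i : Fin (m - k) => Φ^[i] f) ∧
    iterateSpan Φ m e ≤ iterateSpan Φ (m - k) f ⊔ iterateSpan Φ k e := by
  have hle : iterateSpan Φ m e ≤ iterateSpan Φ (m - k) f ⊔ iterateSpan Φ k e := by
    have h1 : ∀ i < m, Φ^[i] e ∈ iterateSpan Φ (m - k) f ⊔ iterateSpan Φ k e := by
      intro i
      induction i using Nat.strong_induction_on with
      | _ i ih =>
        intro hi
        by_cases hik : i < k
        · exact Submodule.mem_sup_right (iterate_mem_iterateSpan hik e)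
        · have h2 : Φ^[i - k] f = ∑ j ∈ Finset.range k,
              qShift (q ^ (i - k)) (B j) • Φ^[i - k + j] e + Φ^[i] e := by
            rw [hf, iterate_sum, Finset.sum_range_succ]
            simp only [iterate_smul, ← Function.iterate_add_apply]
            rw [hBk, map_one, one_smul, Nat.sub_add_cancel (not_lt.1 hik)]
          rw [← sub_eq_iff_eq_add'] at h2
          rw [← h2]
          refine sub_mem (Submodule.mem_sup_left (iterate_mem_iterateSpan (by omega) f))
            (sum_mem fun j hj => Submodule.smul_mem _ _ ?_)
          rw [Finset.mem_range] at hj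
          exact ih _ (by omega) (by omega)
    refine Submodule.span_le.2 ?_
    rintro _ ⟨i, rfl⟩
    exact h1 i i.2
  refine ⟨?_, hle⟩
  rw [linearIndependent_iff_card_le_finrank_span]
  have h3 := finrank_span_eq_card he
  rw [Fintype.card_fin] at h3
  have h4 : Fintype.card (Fin k ⊕ Fin (m - k)) = m := by simp; omega
  rw [h4]
  conv_lhs => rw [← h3]
  rw [Set.finrank, Set.Sum.elim_range, Submodule.span_union, sup_comm]
  have : FiniteDimensional ConvLaurent
      (iterateSpan Φ (m - k) f ⊔ iterateSpan Φ k e : Submodule ConvLaurent M) := by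
    have h5 : FiniteDimensional ConvLaurent (iterateSpan Φ (m - k) f) :=
      FiniteDimensional.span_of_finite _ (Set.finite_range _)
    have h6 : FiniteDimensional ConvLaurent (iterateSpan Φ k e) :=
      FiniteDimensional.span_of_finite _ (Set.finite_range _)
    infer_instance
  exact Submodule.finrank_mono (t := iterateSpan Φ (m - k) f ⊔ iterateSpan Φ k e) hle

/-- Induction on the degree: `L = A * B` and `f = B e` give the submodule generated by `f`,
presented by `A`, and above it a quotient presented by `B`. The output of the factorization on the
orders of `A` is the hypothesis `hb` for `A` with bound `lam`. -/
theorem hasFiltrationBelow_iterateSpan (hq : ‖(q : ℂ)‖ < 1) (hΦ : Function.Injective Φ) (m : ℕ)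
    {a : ℕ → ConvLaurent} (ham : a m = 1) (ha0 : a 0 ≠ 0) (ha : ∀ n, m < n → a n = 0) {e : M}
    (he : LinearIndependent ConvLaurent fun i : Fin m => Φ^[i] e)
    (hrel : ∑ i ∈ Finset.range (m + 1), a i • Φ^[i] e = 0) {b : ℚ}
    (hb : ∀ i, 0 < i → a i ≠ 0 → (ord (a 0) : ℚ) < ord (a i) + b * i) :
    HasFiltrationBelow Φ (iterateSpan Φ m e) b := by
  induction m using Nat.strong_induction_on generalizing a e b with
  | _ m ih =>
    rcases Nat.eq_zero_or_pos m with rfl | hm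
    · have : iterateSpan Φ 0 e = ⊥ := by simp [iterateSpan]
      rw [this]
      exact hasFiltrationBelow_bot hΦ b
    obtain ⟨lam, k, A, B, hk0, hkm, ⟨hak, hord⟩, ⟨hA0, hAm, hA, hAord⟩,
      ⟨hB0, hBk, hB, hB0ord, hBord⟩, hprod⟩ := exists_factorization hq hm ha0 ham ha
    set f := ∑ j ∈ Finset.range (k + 1), B j • Φ^[j] e with hf
    have hAf : ∑ i ∈ Finset.range (m - k + 1), A i • Φ^[i] f = 0 := by
      rw [hf, sum_smul_iterate_sum A B hA hB, Nat.sub_add_cancel hkm, ← hrel]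
      exact Finset.sum_congr rfl fun n _ => by rw [hprod n]
    obtain ⟨hli, hle⟩ := linearIndependent_sumElim_iterate hkm hBk he hf
    obtain ⟨hlie, hlif, hdisj⟩ := linearIndependent_sum.1 hli
    have hN := isStable_iterateSpan hΦ ham ha0 hrel
    have hN' := isStable_iterateSpan hΦ hAm hA0 hAf
    have heN : e ∈ iterateSpan Φ m e := iterate_mem_iterateSpan hm e
    have hfN : f ∈ iterateSpan Φ m e :=
      sum_mem fun j _ => Submodule.smul_mem _ _ (hN.iterate_mem heN j)
    have hfN' : f ∈ iterateSpan Φ (m - k) f := by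
      -- If `k = m` the span is zero, and `A = 1` forces `f = 0`.
      rcases Nat.eq_zero_or_pos (m - k) with h | h
      · rw [h] at hAf hAm
        have : f = 0 := by simpa [hAm] using hAf
        rw [this]
        exact zero_mem _
      · exact iterate_mem_iterateSpan h f
    have hdis : ∀ x ∈ iterateSpan Φ k e, x ∈ iterateSpan Φ (m - k) f → x = 0 := fun x hx hx' =>
      Submodule.disjoint_def.1 hdisj x hx hx'
    have hlt : iterateSpan Φ (m - k) f < iterateSpan Φ m e := by
      refine lt_of_le_of_ne (Submodule.span_le.2 ?_) fun h => ?_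
      · rintro _ ⟨i, rfl⟩
        exact hN.iterate_mem hfN i
      · rw [← h] at heN
        exact he.ne_zero (⟨0, hm⟩ : Fin m) (hdis e (iterate_mem_iterateSpan hk0 e) heN)
    refine (ih (m - k) (by omega) hAm hA0 hA hlif hAf hAord).snoc hN' hN hlt ?_ ?_
    · refine isPure_subquotient hN' hN (m := k) (a := fun i => B i) heN (by simpa using hBk)
        (by simpa using hB0) (fun c hc => ?_) hle ?_ ?_
      · have h1 := hdis _ (sum_mem fun i _ => Submodule.smul_mem _ (c i)
          (iterate_mem_iterateSpan i.2 e)) hc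
        exact funext (Fintype.linearIndependent_iff.1 hlie c h1)
      · rw [Fin.sum_univ_eq_sum_range (fun i => B i • Φ^[i] e)]
        exact hfN'
      · exact newtonSlopes_eq_singleton hk0 (by simpa using hBk) (by simpa using hB0)
          (by simpa using hB0ord) fun i => hBord i (by omega)
    · have h1 := hb k hk0 hak
      rw [hord] at h1
      have h2 : (0 : ℚ) < k := by exact_mod_cast hk0
      exact lt_of_mul_lt_mul_right (by linarith) h2.le

theorem exists_isSlopeFiltration [FiniteDimensional ConvLaurent M] (hq : ‖(q : ℂ)‖ < 1)
    (hΦ : Function.Bijective Φ) :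
    ∃ (r : ℕ) (N : Fin (r + 1) → Submodule ConvLaurent M) (lam : Fin r → ℚ),
      IsSlopeFiltration Φ N lam := by
  set m := Module.finrank ConvLaurent M with hm
  obtain ⟨e, he⟩ := exists_linearIndependent_iterate Φ hq hΦ m le_rfl
  have htop : iterateSpan Φ m e = ⊤ :=
    he.span_eq_top_of_card_eq_finrank' (by simp [hm])
  have hmem : Φ^[m] e ∈ iterateSpan Φ m e := by rw [htop]; trivial
  obtain ⟨c, hc⟩ := (Submodule.mem_span_range_iff_exists_fun _).1 hmem
  let a : ℕ → ConvLaurent := fun n => if h : n < m then -c ⟨n, h⟩ else if n = m then 1 else 0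
  have ham : a m = 1 := by simp [a]
  have hrel : ∑ i ∈ Finset.range (m + 1), a i • Φ^[i] e = 0 := by
    rw [Finset.sum_range_succ, ham, one_smul, ← hc,
      ← Fin.sum_univ_eq_sum_range (fun i => a i • Φ^[i] e), ← Finset.sum_add_distrib]
    exact Finset.sum_eq_zero fun i _ => by simp [a]
  -- If `a 0 = 0`, injectivity of `Φ` cancels one `Φ` from the relation, leaving a dependence among
  -- the first `m` iterates.
  have ha0 : a 0 ≠ 0 := by
    intro h0
    rcases Nat.eq_zero_or_pos m with hm0 | hm0
    · rw [hm0] at ham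
      exact one_ne_zero (ham.symm.trans h0)
    obtain ⟨n, hn⟩ := Nat.exists_eq_succ_of_ne_zero hm0.ne'
    rw [Finset.sum_range_succ', h0, zero_smul, add_zero] at hrel
    have h1 : Φ (∑ i ∈ Finset.range m, (qShift q).symm (a (i + 1)) • Φ^[i] e) = 0 := by
      rw [← hrel, map_sum]
      refine Finset.sum_congr rfl fun i _ => ?_
      rw [map_smul_qShift, RingEquiv.apply_symm_apply, ← Function.iterate_succ_apply' Φ]
    rw [map_eq_zero_iff Φ hΦ.injective,
      ← Fin.sum_univ_eq_sum_range (fun i => (qShift q).symm (a (i + 1)) • Φ^[i] e)] at h1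
    have h2 := Fintype.linearIndependent_iff.1 he _ h1 ⟨n, by omega⟩
    simp only at h2
    rw [← Nat.succ_eq_add_one, ← hn, ham, map_one] at h2
    exact one_ne_zero h2
  obtain ⟨b, hb⟩ : ∃ b : ℚ, ∀ i, 0 < i → a i ≠ 0 → (ord (a 0) : ℚ) < ord (a i) + b * i := by
    refine ⟨1 + ∑ i ∈ Finset.range (m + 1), |(ord (a 0) : ℚ) - ord (a i)|, fun i hi hai => ?_⟩
    have him : i ∈ Finset.range (m + 1) := by
      by_contra! h
      rw [Finset.mem_range] at h
      exact hai (by simp [a, show ¬ i < m by omega, show i ≠ m by omega])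
    have h1 := Finset.single_le_sum (f := fun i => |(ord (a 0) : ℚ) - ord (a i)|)
      (fun _ _ => abs_nonneg _) him
    have h2 : (1 : ℚ) ≤ i := by exact_mod_cast hi
    have h3 := le_abs_self ((ord (a 0) : ℚ) - ord (a i))
    have h4 := abs_nonneg ((ord (a 0) : ℚ) - ord (a i))
    nlinarith
  obtain ⟨r, F, lam, st, h0, hr, hF, hpure, hlam, -⟩ := hasFiltrationBelow_iterateSpan hq
    hΦ.injective m ham ha0 (fun n hn => by simp [a, show ¬ n < m by omega, show n ≠ m by omega])
    he hrel hb
  exact ⟨r, F, lam, st, h0, hr.trans htop, hF, hpure, hlam⟩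

end

/-! ### Uniqueness -/

theorem exists_cut {r : ℕ} {f : Fin r → ℚ} (hf : Monotone f) {x : ℚ} (hx : x ∉ Set.range f) :
    ∃ j, j < r + 1 ∧ ∀ l : Fin r, (l : ℕ) < j ↔ f l < x := by
  classical
  have hex : ∃ j : ℕ, ∀ l : Fin r, j ≤ l → x < f l := ⟨r, fun l hl => absurd l.2 (by omega)⟩
  refine ⟨Nat.find hex, Nat.lt_succ_of_le (Nat.find_le fun l hl => absurd l.2 (by omega)),
    fun l => ⟨fun hl => ?_, fun hl => ?_⟩⟩
  · have h1 := Nat.find_min hex (m := l) hl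
    push Not at h1
    obtain ⟨l', hl', hxl⟩ := h1
    refine lt_of_le_of_ne ((hf (Fin.le_def.2 hl')).trans hxl) fun h => hx ⟨l, h⟩
  · by_contra! h
    exact lt_asymm hl (Nat.find_spec hex l h)

section

variable {q : ℂˣ} {M : Type*} [AddCommGroup M] [Module ConvLaurent M]
  {Φ : M →ₛₗ[(qShift q : ConvLaurent →+* ConvLaurent)] M}

/-- A morphism between pure subquotients of different slopes vanishes. -/
theorem IsPure.le_of_slope_ne {P₁ P₂ Q₁ Q₂ : Submodule ConvLaurent M} {hP₁ : IsStable Φ P₁}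
    {hP₂ : IsStable Φ P₂} {hQ₁ : IsStable Φ Q₁} {hQ₂ : IsStable Φ Q₂} {lam mu : ℚ}
    (hP : IsPure (subquotient Φ P₁ P₂ hP₁ hP₂) lam)
    (hQ : IsPure (subquotient Φ Q₁ Q₂ hQ₁ hQ₂) mu) (hne : lam ≠ mu) (h₁ : P₁ ≤ Q₁)
    (h₂ : P₂ ≤ Q₂) : P₂ ≤ Q₁ := by
  obtain ⟨m, a, e, he, ham, ha0, hspan, hrel, ha⟩ := hP.exists_generator
  have h0 : (Submodule.Quotient.mk ⟨e, h₂ he⟩ : Q₂ ⧸ Q₁.submoduleOf Q₂) = 0 := by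
    refine hQ.eq_zero_of_sum_eq_zero (subquotient_injective hQ₁ hQ₂) ham ha0 ha hne ?_
    rw [sum_smul_subquotient_iterate hQ₁ hQ₂ a (fun i => (i : ℕ)) (h₂ he),
      mk_submoduleOf_eq_zero_iff]
    exact h₁ hrel
  have heQ : e ∈ Q₁ := mk_submoduleOf_eq_zero_iff.1 h0
  refine hspan.trans (sup_le h₁ (Submodule.span_le.2 ?_))
  rintro _ ⟨i, rfl⟩
  exact hQ₁.iterate_mem heQ i

variable {r r' : ℕ} {N : Fin (r + 1) → Submodule ConvLaurent M} {lam : Fin r → ℚ}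
  {N' : Fin (r' + 1) → Submodule ConvLaurent M} {lam' : Fin r' → ℚ}

namespace IsSlopeFiltration

/-- By induction `N i` lies in `N' j`. The next step `N (i + 1)` then descends from the top of the
second tower: each induced map to a quotient at or above `j` vanishes because the slopes differ. -/
theorem le_of_forall_slope_ne (h : IsSlopeFiltration Φ N lam) (h' : IsSlopeFiltration Φ N' lam')
    (i : ℕ) (hi : i < r + 1) (j : ℕ) (hj : j < r' + 1)
    (hne : ∀ s : Fin r, (s : ℕ) < i → ∀ l : Fin r', j ≤ l → lam s ≠ lam' l) :
    N ⟨i, hi⟩ ≤ N' ⟨j, hj⟩ := by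
  induction i with
  | zero => exact h.bot.le.trans bot_le
  | succ i ih =>
    have hi' := ih (by omega) fun s hs => hne s (by omega)
    have key : ∀ d, ∀ l (hl : l < r' + 1), j ≤ l → l + d = r' →
        N ⟨i + 1, hi⟩ ≤ N' ⟨l, hl⟩ := by
      intro d
      induction d with
      | zero =>
        intro l hl _ hlr
        have : (⟨l, hl⟩ : Fin (r' + 1)) = Fin.last r' := Fin.ext (by simpa using hlr)
        rw [this, h'.top]
        exact le_top
      | succ d ihd =>
        intro l hl hjl hlr
        have h2 := ihd (l + 1) (by omega) (by omega) (by omega)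
        exact IsPure.le_of_slope_ne (h.pure ⟨i, by omega⟩) (h'.pure ⟨l, by omega⟩)
          (hne _ (by simp) _ hjl)
          (hi'.trans (h'.strictMono.monotone (by simpa [Fin.le_def] using hjl))) h2
    exact key (r' - j) j hj le_rfl (by omega)

theorem range_subset (h : IsSlopeFiltration Φ N lam) (h' : IsSlopeFiltration Φ N' lam') :
    Set.range lam ⊆ Set.range lam' := by
  rintro _ ⟨s, rfl⟩
  by_contra hs
  -- Cutting the second tower at the missing slope `lam s` would give `N (s + 1) ≤ N' j ≤ N s`,
  -- against strictness.
  obtain ⟨j, hj, hcut⟩ := exists_cut h'.slopes_strictMono.monotone hs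
  have h1 := h.le_of_forall_slope_ne h' (s + 1) (by omega) j hj fun t ht l hl => by
    have h2 : lam t ≤ lam s := h.slopes_strictMono.monotone (Fin.le_def.2 (by omega))
    have h3 : lam s ≤ lam' l := not_lt.1 fun hlt => absurd ((hcut l).2 hlt) (by omega)
    exact fun heq => hs ⟨l, le_antisymm (heq ▸ h2) h3⟩
  have h4 := h'.le_of_forall_slope_ne h j hj s (by omega) fun l hl t ht =>
    (((hcut l).1 hl).trans_le (h.slopes_strictMono.monotone (Fin.le_def.2 ht))).ne
  exact absurd (h1.trans h4) (not_le_of_gt (h.strictMono (Fin.castSucc_lt_succ (i := s))))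

/-- Two increasing enumerations of the same set of slopes coincide. With equal slopes, those below
an index differ from those at or above it, so the comparison applies in both directions. -/
theorem unique (h : IsSlopeFiltration Φ N lam) (h' : IsSlopeFiltration Φ N' lam') :
    ∃ e : r' = r, (∀ i : Fin (r' + 1), N' i = N (Fin.cast (congrArg (· + 1) e) i)) ∧
      ∀ i : Fin r', lam' i = lam (Fin.cast e i) := by
  have hrange : Set.range lam' = Set.range lam :=
    (h'.range_subset h).antisymm (h.range_subset h')
  have hr : r' = r := by
    have h1 := Nat.card_range_of_injective h.slopes_strictMono.injective
    have h2 := Nat.card_range_of_injective h'.slopes_strictMono.injective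
    rw [hrange, h1] at h2
    simpa using h2.symm
  subst hr
  have hlam : lam' = lam := (h'.slopes_strictMono.range_inj h.slopes_strictMono).1 hrange
  subst hlam
  have hne : ∀ i : ℕ, ∀ s : Fin r', (s : ℕ) < i → ∀ l : Fin r', i ≤ l → lam' s ≠ lam' l :=
    fun i s hs l hl => (h.slopes_strictMono (Fin.lt_def.2 (hs.trans_le hl))).ne
  exact ⟨rfl, fun i => le_antisymm (h'.le_of_forall_slope_ne h i i.2 i i.2 (hne i))
    (h.le_of_forall_slope_ne h' i i.2 i i.2 (hne i)), fun i => rfl⟩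

end IsSlopeFiltration

end

end QDiff

theorem theorem3p2 (q : ℂˣ) (hq : ‖(q : ℂ)‖ < 1)
    {M : Type*} [AddCommGroup M] [Module QDiff.ConvLaurent M]
    [FiniteDimensional QDiff.ConvLaurent M]
    (Φ : M →ₛₗ[(QDiff.qShift q : QDiff.ConvLaurent →+* QDiff.ConvLaurent)] M)
    (hΦ : Function.Bijective Φ) :
    ∃ (r : ℕ) (N : Fin (r + 1) → Submodule QDiff.ConvLaurent M) (lam : Fin r → ℚ),
      QDiff.IsSlopeFiltration Φ N lam ∧
      ∀ (r' : ℕ) (N' : Fin (r' + 1) → Submodule QDiff.ConvLaurent M) (lam' : Fin r' → ℚ),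
        QDiff.IsSlopeFiltration Φ N' lam' →
          ∃ h : r' = r, (∀ i : Fin (r' + 1), N' i = N (Fin.cast (congrArg (· + 1) h) i)) ∧
            ∀ i : Fin r', lam' i = lam (Fin.cast h i) := by
  obtain ⟨r, N, lam, h⟩ := QDiff.exists_isSlopeFiltration (Φ := Φ) hq hΦ
  exact ⟨r, N, lam, h, fun _ _ _ h' => h.unique h'⟩
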